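/- Let $\Omega\subset\mathbb R^2$ be open and let $f:\Omega\to\mathbb R^2$ be a smooth flux such that, for every $u\in\Omega$, $Df(u)$ has real eigenvalues $\lambda_1(u)<\lambda_2(u)$, with eigenvectors $r_1(u),r_2(u)$ satisfying $r_i\cdot\nabla\lambda_i\ge 0$ in $\Omega$ for $i=1,2$. Let $\overline u\in\Omega$ and let $w=(w_1,w_2)=w[u]$ be Riemann coordinates near $\overline u$: a smooth diffeomorphism from an open neighborhood $W\subset\Omega$ of $\overline u$ onto an open subset of $\mathbb R^2$ such that $\partial u/\partial w_i=r_i(u)$, where the $r_i$ are normalized by suitable positive factors. For $u\in W$ let $\mathcal R_i(s;u)$ be the state reached at parameter $s$ (of either sign) on the integral curve of the normalized $r_i$ issued from $u$, and let $\mathcal S_i(s;u)$ be the state reached at parameter $s$ on the $i$-th Hugoniot curve issued from $u$, i.e. the smooth curve of states $v$ satisfying $f(v)-f(u)=\mu\,(v-u)$ for some $\mu\in\mathbb R$ that starts from $u$ in the direction of $r_i(u)$; both curves lie in $W$ and are parameterized by the jump of $w_i$. Let $\mathcal T_i(s;u)=\mathcal R_i(s;u)$ if $s\ge0$ and $\mathcal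 T_i(s;u)=\mathcal S_i(s;u)$ if $s\le 0$. For a wave on the curve $\mathcal T_i$, of strength $\sigma$, put $\sigma_*=\min(\sigma,0)$ (so $\sigma_*=\sigma$ for a shock and $\sigma_*=0$ for a rarefaction). Then there exist an open neighborhood $U\subset W$ of $\overline u$ and $c>0$ such that: * for all $\mathcal U_1\in\{\mathcal R_1,\mathcal T_1\}$, $\mathcal U_2\in\{\mathcal R_2,\mathcal T_2\}$ and $u_l,u_r\in U$ there are unique $\sigma_1,\sigma_2\in(-c,c)$ with $u_r=\mathcal U_2(\sigma_2;\mathcal U_1(\sigma_1;u_l))$, and every wave on one of the curves $\mathcal R_i,\mathcal T_i$ joining two states of $U$ has its strength in $(-c,c)$; * there are functions $\mathcal C^1(u_m;s_1,s_2)$ and $\mathcal C^2(u_m;s_1,s_2)$, Lipschitz on $U\times(-c,c)^2$, and a constant $M$, for which the following holds for all states $u_l,u_m,u_r\in U$. **1.** If $u_m=\mathcal T_2(\sigma_2;u_l)$ and $u_r=\mathcal T_1(\sigma_1;u_m)$, then $u_r=\mathcal T_2(\sigma_2';\mathcal T_1(\sigma_1';u_l))$ with $\sigma_1',\sigma_2'\in(-c,c)$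 and $$\sigma_1'=\sigma_1\big(1+\mathcal C^1(u_m;\sigma_1,\sigma_2)(\sigma_2)_*^3\big),\qquad \sigma_2'=\sigma_2\big(1+\mathcal C^2(u_m;\sigma_1,\sigma_2)(\sigma_1)_*^3\big).$$ **2.** If $u_m=\mathcal T_2(\sigma_2;u_l)$ and $u_r=\mathcal R_1(\sigma_1;u_m)$, then $u_r=\mathcal T_2(\sigma_2';\mathcal R_1(\sigma_1';u_l))$ with $\sigma_1',\sigma_2'\in(-c,c)$ and, for some $\theta$ with $|\theta|\le M$, $$\sigma_1'=\sigma_1\big(1+\mathcal C^1(u_m;\sigma_1,\sigma_2)(\sigma_2)_*^3+\theta\,|\sigma_1|^2(\sigma_2)_*^3\big),\qquad \sigma_2'=\sigma_2.$$ If $u_m=\mathcal R_2(\sigma_2;u_l)$ and $u_r=\mathcal T_1(\sigma_1;u_m)$, then $u_r=\mathcal R_2(\sigma_2';\mathcal T_1(\sigma_1';u_l))$ with $\sigma_1',\sigma_2'\in(-c,c)$ and, for some $\theta$ with $|\theta|\le M$, $$\sigma_1'=\sigma_1,\qquad \sigma_2'=\sigma_2\big(1+\mathcal C^2(u_m;\sigma_1,\sigma_2)(\sigma_1)_*^3+\theta\,|\sigma_2|^2(\sigma_1)_*^3\big).$$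 **3.** If $u_m=\mathcal R_2(\sigma_2;u_l)$ and $u_r=\mathcal R_1(\sigma_1;u_m)$, then $u_r=\mathcal R_2(\sigma_2;\mathcal R_1(\sigma_1;u_l))$. -/

import Mathlib

open Set
open scoped NNReal ContDiff

/-- The plane `ℝ²` of states, with its Euclidean norm. -/
abbrev Plane : Type := EuclideanSpace ℝ (Fin 2)

/-- A strictly hyperbolic `2 × 2` system of conservation laws `u_t + f(u)_x = 0` with smooth flux
`f : Ω → ℝ²`.  The families are indexed by `Fin 2`: index `0` is the first (slow) family and
index `1` is the second (fast) family.  `lam i u` is the `i`-th eigenvalue of `Df(u)` and `r i u` is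
an eigenvector for it. -/
structure HyperbolicSystem where
  Ω : Set Plane
  isOpen_Ω : IsOpen Ω
  f : Plane → Plane
  smooth_f : ContDiffOn ℝ ∞ f Ω
  lam : Fin 2 → Plane → ℝ
  r : Fin 2 → Plane → Plane
  r_ne_zero : ∀ i, ∀ u ∈ Ω, r i u ≠ 0
  eigen : ∀ i, ∀ u ∈ Ω, fderiv ℝ f u (r i u) = lam i u • r i u
  strict : ∀ u ∈ Ω, lam 0 u < lam 1 u

/-- Both characteristic fields are monotone: `r_i · ∇ λ_i ≥ 0` in `Ω`. -/
def HyperbolicSystem.IsMonotone (S : HyperbolicSystem) : Prop :=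
  ∀ i, ∀ u ∈ S.Ω, 0 ≤ fderiv ℝ (S.lam i) u (S.r i u)

/-- Riemann coordinates near `ubar`: a smooth diffeomorphism `u ↦ w[u]` from an open neighborhood
of `ubar` in `Ω` onto an open subset of `ℝ²`, such that `∂u/∂w_i` is an eigenvector of the `i`-th
family, with the orientation of `r_i`.  The positive factor `a` is the normalization of `r_i`. -/
structure RiemannCoordinates (S : HyperbolicSystem) (ubar : Plane) where
  chart : OpenPartialHomeomorph Plane Plane
  base_mem : ubar ∈ chart.source
  source_subset : chart.source ⊆ S.Ω
  smooth_chart : ContDiffOn ℝ ∞ chart chart.source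
  smooth_symm : ContDiffOn ℝ ∞ chart.symm chart.target
  normalized : ∀ i, ∀ u ∈ chart.source, ∃ a : ℝ, 0 < a ∧
    fderiv ℝ chart.symm (chart u) (EuclideanSpace.single i 1) = a • S.r i u

/-- The two types of wave curves used in the Riemann problems: the Lax curves `𝓣_i`
(rarefactions and shocks) and the complete rarefaction curves `𝓡_i`
(rarefactions and compression waves). -/
inductive WaveKind where
  | lax : WaveKind
  | rar : WaveKind

/-- The number `σ_*` of a wave of strength `σ` on a curve of the given kind: it is `σ` when the wave
is a shock and `0` otherwise. -/
def WaveKind.star : WaveKind → ℝ → ℝ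
  | .lax, σ => min σ 0
  | .rar, _ => 0

namespace RiemannCoordinates

variable {S : HyperbolicSystem} {ubar : Plane}

/-- The normalized `i`-th eigenvector field `∂u/∂w_i`. -/
noncomputable def field (w : RiemannCoordinates S ubar) (i : Fin 2) (u : Plane) : Plane :=
  fderiv ℝ w.chart.symm (w.chart u) (EuclideanSpace.single i 1)

/-- `u' = 𝓡_i(s; u)`: the integral curve of the normalized field `r_i` issued from `u` reaches `u'`
at the parameter `s`, which may have any sign.  Along this curve `w_i` grows at unit speed, so `s`
is the jump of `w_i`. -/
def Rarefaction (w : RiemannCoordinates S ubar) (i : Fin 2) (s : ℝ) (u u' : Plane) : Prop :=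
  ∃ γ : ℝ → Plane, γ 0 = u ∧ γ s = u' ∧ ∀ t ∈ uIcc 0 s,
    γ t ∈ w.chart.source ∧ HasDerivWithinAt γ (w.field i (γ t)) (uIcc 0 s) t

/-- `u' = 𝓢_i(s; u)`: the `i`-th Hugoniot curve issued from `u`, i.e. the smooth curve of states
that satisfy the Rankine-Hugoniot relation with `u` and that starts from `u` in the direction of
`r_i`, parameterized by the jump of `w_i`, reaches `u'` at the parameter `s`. -/
def Hugoniot (w : RiemannCoordinates S ubar) (i : Fin 2) (s : ℝ) (u u' : Plane) : Prop :=
  ∃ γ : ℝ → Plane, γ 0 = u ∧ γ s = u' ∧ ContDiffOn ℝ ∞ γ (uIcc 0 s) ∧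
    HasDerivWithinAt γ (w.field i u) (uIcc 0 s) 0 ∧
    ∀ t ∈ uIcc 0 s, γ t ∈ w.chart.source ∧ w.chart (γ t) i = w.chart u i + t ∧
      ∃ μ : ℝ, S.f (γ t) - S.f u = μ • (γ t - u)

/-- `u' = 𝓤_i(s; u)` with `𝓤_i = 𝓡_i` for the kind `rar`, and with `𝓤_i = 𝓣_i` for the kind `lax`,
where `𝓣_i` is `𝓡_i` for `s ≥ 0` and `𝓢_i` for `s ≤ 0`. -/
def Wave (w : RiemannCoordinates S ubar) : WaveKind → Fin 2 → ℝ → Plane → Plane → Prop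
  | .lax, i, s, u, u' => (0 ≤ s ∧ w.Rarefaction i s u u') ∨ (s ≤ 0 ∧ w.Hugoniot i s u u')
  | .rar, i, s, u, u' => w.Rarefaction i s u u'

/-- `ur = 𝓤_2(σ₂; 𝓤_1(σ₁; ul))`, with `𝓤_1` and `𝓤_2` of the kinds `k₁` and `k₂`. -/
def Solves (w : RiemannCoordinates S ubar) (k₁ k₂ : WaveKind) (σ₁ σ₂ : ℝ) (ul ur : Plane) : Prop :=
  ∃ um : Plane, w.Wave k₁ 0 σ₁ ul um ∧ w.Wave k₂ 1 σ₂ um ur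

/-- For every choice of the kinds of curves, the Riemann problem between two states of `U` has
exactly one solution with strengths in `(-c, c)`. -/
def RiemannSolvable (w : RiemannCoordinates S ubar) (U : Set Plane) (c : ℝ) : Prop :=
  ∀ k₁ k₂ : WaveKind, ∀ ul ∈ U, ∀ ur ∈ U,
    ∃! σ : ℝ × ℝ, σ ∈ Ioo (-c) c ×ˢ Ioo (-c) c ∧ w.Solves k₁ k₂ σ.1 σ.2 ul ur

/-- `ul`, `um`, `ur` are states of `U` with `um = 𝓤_2(σ₂; ul)` and `ur = 𝓤_1(σ₁; um)`: a wave of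
the second family on the left meets a wave of the first family on the right. -/
def Incoming (w : RiemannCoordinates S ubar) (U : Set Plane) (k₁ k₂ : WaveKind) (σ₁ σ₂ : ℝ)
    (ul um ur : Plane) : Prop :=
  ul ∈ U ∧ um ∈ U ∧ ur ∈ U ∧ w.Wave k₂ 1 σ₂ ul um ∧ w.Wave k₁ 0 σ₁ um ur

end RiemannCoordinates

/-- The function `(u_m; s₁, s₂) ↦ C(u_m; s₁, s₂)` is Lipschitz on `U × (-c, c)²`. -/
def LipschitzCoefficient (C : Plane → ℝ → ℝ → ℝ) (U : Set Plane) (c : ℝ) : Prop :=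
  ∃ K : ℝ≥0, LipschitzOnWith K (fun p : Plane × ℝ × ℝ => C p.1 p.2.1 p.2.2)
    (U ×ˢ (Ioo (-c) c ×ˢ Ioo (-c) c))

open Filter Topology MeasureTheory

/-!
# Interaction of two waves of different families in a `2 × 2` system

In Riemann coordinates a rarefaction curve of the `i`-th family is a segment parallel to the `i`-th
axis.  The Hugoniot locus of a state `p` near the base point is found by dividing the secants of
`u(w)` and of `f(u(w))` by the jump `s` of `w_i` (Hadamard's lemma): it is the zero set of a smooth
function of `(p, s)` and of the slope `z` of the secant, and its derivative in `z` at the base point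
is a multiple of `λ_2 - λ_1`.  Hence `z = ζ(p, s)` with `ζ` smooth and `ζ(p, 0) = 0`.  The
Rankine–Hugoniot relation is symmetric in the two states, so `ζ` takes the same value at a state and,
for the opposite jump, at the other end of the secant; this forces `ζ / s` to vanish at `s = 0`, and
`ζ(p, s) = s ^ 2 * φ(p, s)` with `φ` smooth and with the same symmetry (`exists_hugoniot`).  A
connectedness argument shows that the Hugoniot curves of the definition are the graphs so obtained
(`RiemannCoordinates.exists_hugoniot_iff`).  A wave of strength `σ` is therefore the jump
`σ • (e_i + σ_* ^ 2 * φ_i • e_j)` (`RiemannCoordinates.exists_wave_iff`).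

Since `σ_* ^ 2` is of class `C¹`, the Riemann problem is solved by the implicit function theorem
(`exists_riemannSolver`).

For an interaction with middle state `p`, write the outgoing strengths as
`σ₁ (1 + Γ₁ (σ₂)_* ^ 3)` and `σ₂ (1 + Γ₂ (σ₁)_* ^ 3)`.  The incoming 2-wave can be issued from `p` by
the symmetry of `φ`, and so can the outgoing one from the right state.  The jump conditions then say
that `σ₁ Γ₁` and `σ₂ Γ₂` are differences of values of `φ`, up to factors close to `1`, and these
differences vanish with `σ₁`, respectively with `σ₂` (`InteractionEqs`).  Dividing by `σ₁` and `σ₂` with Hadamard's lemma leaves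
a `C¹` system for `(Γ₁, Γ₂)` in which each unknown is multiplied by some `σ_* ^ 2`, hence a `C¹`
solution near the base point (`exists_interactionCoefficients`).  Replacing a Lax curve by a
rarefaction curve only replaces a factor `σ_* ^ 2` by `0` in this system, so it changes the
coefficient by `O(σ ^ 2)`.
-/

/-! ### Parametric integrals, division by a parameter, implicit functions -/

/-- The induction on the order of differentiability passes from `E` to `H →L[ℝ] E`, so the target
space is quantified after `n`. -/
theorem contDiff_parametric_integral_nat {H : Type} [NormedAddCommGroup H] [NormedSpace ℝ H]
    [FiniteDimensional ℝ H] (n : ℕ) : ∀ {E : Type} [NormedAddCommGroup E] [NormedSpace ℝ E]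
    [CompleteSpace E] {g : H × ℝ → E}, ContDiff ℝ ∞ g →
    ContDiff ℝ n (fun x => ∫ t in (0 : ℝ)..1, g (x, t)) := by
  induction n with
  | zero =>
    intro E _ _ _ g hg
    simp only [Nat.cast_zero, contDiff_zero]
    exact intervalIntegral.continuous_parametric_intervalIntegral_of_continuous'
      (f := fun x t => g (x, t)) hg.continuous 0 1
  | succ n ih =>
    intro E _ _ _ g hg
    have hgd : Differentiable ℝ g := hg.differentiable (by simp)
    have hg' : ContDiff ℝ ∞ fun p : H × ℝ =>
        (fderiv ℝ g p).comp (ContinuousLinearMap.inl ℝ H ℝ) :=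
      (hg.fderiv_right (m := ∞) (by simp)).clm_comp contDiff_const
    rw [Nat.cast_add, Nat.cast_one, contDiff_succ_iff_hasFDerivAt]
    refine ⟨fun x => ∫ t in (0 : ℝ)..1, (fderiv ℝ g (x, t)).comp (ContinuousLinearMap.inl ℝ H ℝ),
      ih hg', fun x => ?_⟩
    have hK : IsCompact (Metric.closedBall x 1 ×ˢ Icc (0 : ℝ) 1) :=
      (isCompact_closedBall x 1).prod isCompact_Icc
    obtain ⟨C, hC⟩ := hK.exists_bound_of_continuousOn hg'.continuous.continuousOn
    refine intervalIntegral.hasFDerivAt_integral_of_dominated_of_fderiv_le (bound := fun _ => C)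
      (F := fun x t => g (x, t))
      (F' := fun x t => (fderiv ℝ g (x, t)).comp (ContinuousLinearMap.inl ℝ H ℝ))
      (Metric.closedBall_mem_nhds x one_pos) ?_ ?_ ?_ ?_ ?_ ?_
    · refine Eventually.of_forall fun y => ?_
      exact (hg.continuous.comp (Continuous.prodMk_right y)).aestronglyMeasurable
    · exact (hg.continuous.comp (Continuous.prodMk_right x)).intervalIntegrable _ _
    · exact (hg'.continuous.comp (Continuous.prodMk_right x)).aestronglyMeasurable
    · refine Eventually.of_forall fun t ht y hy => hC (y, t) ⟨hy, ?_⟩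
      rw [uIoc_of_le zero_le_one] at ht
      exact ⟨ht.1.le, ht.2⟩
    · exact intervalIntegrable_const
    · refine Eventually.of_forall fun t _ y _ => ?_
      have h1 : HasFDerivAt (fun y : H => (y, t)) (ContinuousLinearMap.inl ℝ H ℝ) y :=
        hasFDerivAt_prodMk_left y t
      exact (hgd (y, t)).hasFDerivAt.comp y h1

theorem contDiff_parametric_integral {H : Type} [NormedAddCommGroup H] [NormedSpace ℝ H]
    [FiniteDimensional ℝ H] {E : Type} [NormedAddCommGroup E] [NormedSpace ℝ E]
    [CompleteSpace E] {g : H × ℝ → E} (hg : ContDiff ℝ ∞ g) :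
    ContDiff ℝ ∞ (fun x => ∫ t in (0 : ℝ)..1, g (x, t)) :=
  contDiff_infty.2 fun n => contDiff_parametric_integral_nat n hg

/-- Hadamard's lemma: the increment of a smooth function in its last variable is divisible by that
variable, with a smooth quotient. -/
theorem exists_smooth_quotient {H : Type} [NormedAddCommGroup H] [NormedSpace ℝ H]
    [FiniteDimensional ℝ H] {E : Type} [NormedAddCommGroup E] [NormedSpace ℝ E]
    [CompleteSpace E] {g : H × ℝ → E} (hg : ContDiff ℝ ∞ g) :
    ∃ q : H × ℝ → E, ContDiff ℝ ∞ q ∧ (∀ x s, g (x, s) = g (x, 0) + s • q (x, s)) ∧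
      ∀ x, HasDerivAt (fun s => g (x, s)) (q (x, 0)) 0 := by
  have hgd : Differentiable ℝ g := hg.differentiable (by simp)
  let k : (H × ℝ) × ℝ → E := fun p => fderiv ℝ g (p.1.1, p.2 * p.1.2) (0, 1)
  have hk : ContDiff ℝ ∞ k := by
    refine ContDiff.clm_apply ?_ contDiff_const
    exact (hg.fderiv_right (m := ∞) (by simp)).comp (by fun_prop)
  have hder : ∀ x t, HasDerivAt (fun s => g (x, s)) (fderiv ℝ g (x, t) (0, 1)) t := by
    intro x t
    have h1 : HasDerivAt (fun s : ℝ => (x, s)) ((0 : H), (1 : ℝ)) t :=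
      (hasDerivAt_const t x).prodMk (hasDerivAt_id t)
    exact (hgd (x, t)).hasFDerivAt.comp_hasDerivAt t h1
  refine ⟨fun p => ∫ t in (0 : ℝ)..1, k (p, t), contDiff_parametric_integral hk, ?_, ?_⟩
  · intro x s
    have hc : ∀ t ∈ uIcc (0 : ℝ) 1,
        HasDerivAt (fun t => g (x, t * s)) (s • k ((x, s), t)) t := by
      intro t _
      have h2 : HasDerivAt (fun t : ℝ => t * s) s t := by
        simpa using (hasDerivAt_id t).mul_const s
      exact (hder x (t * s)).scomp t h2
    have hcont : Continuous fun t => s • k ((x, s), t) :=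
      (hk.continuous.comp (Continuous.prodMk_right (x, s))).const_smul s
    have := intervalIntegral.integral_eq_sub_of_hasDerivAt hc (hcont.intervalIntegrable 0 1)
    rw [intervalIntegral.integral_smul] at this
    simp only [one_mul, zero_mul] at this
    simp only [this]
    abel
  · intro x
    simpa [k] using hder x 0

/-- A function smooth on a neighborhood of a point agrees near it with a globally smooth one. -/
theorem exists_contDiff_eventuallyEq {E F : Type} [NormedAddCommGroup E] [NormedSpace ℝ E]
    [FiniteDimensional ℝ E] [NormedAddCommGroup F] [NormedSpace ℝ F] {g : E → F} {x₀ : E}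
    (hg : ∀ᶠ x in 𝓝 x₀, ContDiffAt ℝ ∞ g x) :
    ∃ h : E → F, ContDiff ℝ ∞ h ∧ h =ᶠ[𝓝 x₀] g := by
  obtain ⟨ε, hε, hball⟩ := Metric.eventually_nhds_iff_ball.1 hg
  let χ : ContDiffBump x₀ := ⟨ε / 4, ε / 2, by positivity, by linarith⟩
  refine ⟨fun x => χ x • g x, contDiff_iff_contDiffAt.2 fun x => ?_, ?_⟩
  · by_cases hx : x ∈ tsupport χ
    · refine χ.contDiffAt.smul (hball x ?_)
      rw [χ.tsupport_eq] at hx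
      exact Metric.closedBall_subset_ball (by simp only [χ]; linarith) hx
    · have h0 : (fun x => χ x • g x) =ᶠ[𝓝 x] fun _ => 0 := by
        filter_upwards [notMem_tsupport_iff_eventuallyEq.1 hx] with y hy
        simp [hy]
      exact contDiffAt_const.congr_of_eventuallyEq h0
  · filter_upwards [χ.eventuallyEq_one] with x hx
    simp [hx]

theorem ContinuousLinearMap.isInvertible_of_apply_one_ne_zero {A : ℝ →L[ℝ] ℝ} (hA : A 1 ≠ 0) :
    A.IsInvertible := by
  refine ⟨ContinuousLinearEquiv.smulLeft (Units.mk0 (A 1) hA), ?_⟩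
  ext
  simp [Units.smul_def]

/-- The implicit function theorem for a smooth scalar equation in a scalar unknown, with a globally
smooth implicit function. -/
theorem exists_smooth_implicitFunction {E : Type} [NormedAddCommGroup E] [NormedSpace ℝ E]
    [FiniteDimensional ℝ E] {G : E × ℝ → ℝ} (hG : ContDiff ℝ ∞ G) {x₀ : E} {y₀ : ℝ}
    (h0 : G (x₀, y₀) = 0) (h1 : fderiv ℝ G (x₀, y₀) (0, 1) ≠ 0) :
    ∃ ζ : E → ℝ, ContDiff ℝ ∞ ζ ∧ ζ x₀ = y₀ ∧
      ∀ᶠ v in 𝓝 (x₀, y₀), G v = 0 ↔ v.2 = ζ v.1 := by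
  have : CompleteSpace E := FiniteDimensional.complete ℝ E
  have hinv : ∀ v : E × ℝ, fderiv ℝ G v (0, 1) ≠ 0 →
      (fderiv ℝ G v ∘L .inr ℝ E ℝ).IsInvertible := fun v hv =>
    ContinuousLinearMap.isInvertible_of_apply_one_ne_zero (by simpa using hv)
  have hI := hinv _ h1
  have hn : (∞ : WithTop ℕ∞) ≠ 0 := by simp
  have hGa : ∀ v, ContDiffAt ℝ ∞ G v := fun v => hG.contDiffAt
  set g := (hGa (x₀, y₀)).implicitFunction hn hI with hg
  have hg0 : g x₀ = y₀ := (hGa (x₀, y₀)).implicitFunction_apply_self hn hI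
  have hiff : ∀ᶠ v in 𝓝 (x₀, y₀), G v = 0 ↔ g v.1 = v.2 := by
    have := (hGa (x₀, y₀)).eventually_apply_eq_iff_implicitFunction hn hI
    rwa [h0] at this
  have hgc : ContinuousAt g x₀ := ((hGa (x₀, y₀)).contDiffAt_implicitFunction hn hI).continuousAt
  have hpair : Tendsto (fun x => (x, g x)) (𝓝 x₀) (𝓝 (x₀, y₀)) := by
    have := (continuousAt_id (x := x₀)).prodMk hgc
    simpa [ContinuousAt, hg0] using this
  have hne : ∀ᶠ v in 𝓝 (x₀, y₀), fderiv ℝ G v (0, 1) ≠ 0 := by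
    have : Continuous fun v => fderiv ℝ G v (0, 1) :=
      (hG.continuous_fderiv (by simp)).clm_apply continuous_const
    exact this.continuousAt.eventually_ne h1
  -- near `x₀` the implicit functions based at the points of the graph of `g` are all equal to `g`
  have hsmooth : ∀ᶠ x in 𝓝 x₀, ContDiffAt ℝ ∞ g x := by
    filter_upwards [hpair.eventually hiff.eventually_nhds, hpair.eventually hne] with x hx hx1
    have hGx : G (x, g x) = 0 := hx.self_of_nhds.2 rfl
    have hJ := hinv _ hx1
    have hcd := (hGa (x, g x)).contDiffAt_implicitFunction hn hJ
    have hev := (hGa (x, g x)).eventually_apply_implicitFunction hn hJ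
    have hself := (hGa (x, g x)).implicitFunction_apply_self hn hJ
    set g' := (hGa (x, g x)).implicitFunction hn hJ with hg'
    have hp' : Tendsto (fun y => (y, g' y)) (𝓝 x) (𝓝 (x, g x)) := by
      have := (continuousAt_id (x := x)).prodMk hcd.continuousAt
      simpa [ContinuousAt, hself] using this
    refine hcd.congr_of_eventuallyEq ?_
    filter_upwards [hev, hp'.eventually hx] with y hy hy'
    exact hy'.1 (by rw [hy, hGx])
  obtain ⟨ζ, hζ, hζg⟩ := exists_contDiff_eventuallyEq hsmooth
  refine ⟨ζ, hζ, by rw [hζg.self_of_nhds, hg0], ?_⟩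
  have : ∀ᶠ v in 𝓝 (x₀, y₀), ζ v.1 = g v.1 :=
    (continuous_fst.tendsto (x₀, y₀)).eventually hζg
  filter_upwards [this, hiff] with v h1 h2
  rw [h2, h1, eq_comm]

/-- The implicit function theorem for an equation of class `C¹` whose partial derivative in the
unknown is the identity at the base point. -/
theorem exists_implicitFunction_of_hasFDerivAt_id {E F : Type} [NormedAddCommGroup E]
    [NormedSpace ℝ E] [CompleteSpace E] [NormedAddCommGroup F] [NormedSpace ℝ F] [CompleteSpace F]
    {G : E × F → F} {x₀ : E} {y₀ : F} (hG : ContDiffAt ℝ 1 G (x₀, y₀)) (h0 : G (x₀, y₀) = 0)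
    (h1 : HasFDerivAt (fun y => G (x₀, y)) (ContinuousLinearMap.id ℝ F) y₀) :
    ∃ g : E → F, ContDiffAt ℝ 1 g x₀ ∧ g x₀ = y₀ ∧
      ∀ᶠ v in 𝓝 (x₀, y₀), G v = 0 ↔ v.2 = g v.1 := by
  have hI : (fderiv ℝ G (x₀, y₀) ∘L .inr ℝ E F).IsInvertible := by
    have h2 : HasFDerivAt (fun y => G (x₀, y)) (fderiv ℝ G (x₀, y₀) ∘L .inr ℝ E F) y₀ :=
      (hG.differentiableAt one_ne_zero).hasFDerivAt.comp y₀ (hasFDerivAt_prodMk_right x₀ y₀)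
    rw [h2.unique h1]
    exact ⟨ContinuousLinearEquiv.refl ℝ F, rfl⟩
  refine ⟨hG.implicitFunction one_ne_zero hI, hG.contDiffAt_implicitFunction one_ne_zero hI,
    hG.implicitFunction_apply_self one_ne_zero hI, ?_⟩
  have := hG.eventually_apply_eq_iff_implicitFunction one_ne_zero hI
  rw [h0] at this
  filter_upwards [this] with v hv
  rw [hv, eq_comm]

/-! ### The Hugoniot locus in coordinates -/

/-- The `i`-th coordinate vector of the plane. -/
noncomputable abbrev coordVec (i : Fin 2) : Plane := EuclideanSpace.single i 1

/-- The determinant of two vectors of the plane. -/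
def cross (v v' : Plane) : ℝ := v 0 * v' 1 - v 1 * v' 0

theorem cross_neg_neg (v v' : Plane) : cross (-v) (-v') = cross v v' := by
  simp [cross]

theorem cross_smul_smul (s : ℝ) (v v' : Plane) : cross (s • v) (s • v') = s ^ 2 * cross v v' := by
  simp [cross]; ring

theorem ContDiff.cross {E : Type} [NormedAddCommGroup E] [NormedSpace ℝ E] {n : WithTop ℕ∞}
    {g h : E → Plane} (hg : ContDiff ℝ n g) (hh : ContDiff ℝ n h) :
    ContDiff ℝ n fun x => cross (g x) (h x) := by
  have h1 := (contDiff_euclidean (n := n)).1 hg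
  have h2 := (contDiff_euclidean (n := n)).1 hh
  exact ((h1 0).mul (h2 1)).sub ((h1 1).mul (h2 0))

/-- The point reached from `p` after a jump `s` of the `i`-th coordinate along a secant of slope
`z`. -/
noncomputable def secant (i : Fin 2) (p : Plane) (s z : ℝ) : Plane :=
  p + s • (coordVec i + z • coordVec i.rev)

theorem secant_zero (i : Fin 2) (p : Plane) (z : ℝ) : secant i p 0 z = p := by
  simp [secant]

theorem secant_neg_secant (i : Fin 2) (p : Plane) (s z : ℝ) :
    secant i (secant i p s z) (-s) z = p := by
  simp only [secant, neg_smul]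
  abel

theorem ContDiff.secant {E : Type} [NormedAddCommGroup E] [NormedSpace ℝ E] {n : WithTop ℕ∞}
    {g : E → Plane} {h k : E → ℝ} (i : Fin 2) (hg : ContDiff ℝ n g) (hh : ContDiff ℝ n h)
    (hk : ContDiff ℝ n k) : ContDiff ℝ n fun x => secant i (g x) (h x) (k x) :=
  hg.add (hh.smul (contDiff_const.add (hk.smul contDiff_const)))

/-- The Rankine–Hugoniot determinant of two states of a system given in coordinates by the
states `X` and the fluxes `F`. -/
def rankineHugoniot (X F : Plane → Plane) (p p' : Plane) : ℝ := cross (X p' - X p) (F p' - F p)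

theorem rankineHugoniot_symm (X F : Plane → Plane) (p p' : Plane) :
    rankineHugoniot X F p p' = rankineHugoniot X F p' p := by
  rw [rankineHugoniot, ← cross_neg_neg, neg_sub, neg_sub, rankineHugoniot]

/-- The increment of `X` along a secant is divisible by the jump, uniformly in the slope. -/
theorem exists_secant_quotient {X : Plane → Plane} (hX : ContDiff ℝ ∞ X) (i : Fin 2) :
    ∃ Q : (Plane × ℝ) × ℝ → Plane, ContDiff ℝ ∞ Q ∧
      (∀ p s z, X (secant i p s z) - X p = s • Q ((p, s), z)) ∧
      ∀ p z, Q ((p, 0), z) = fderiv ℝ X p (coordVec i) + z • fderiv ℝ X p (coordVec i.rev) := by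
  let g : (Plane × ℝ) × ℝ → Plane := fun v => X (secant i v.1.1 v.2 v.1.2)
  have hg : ContDiff ℝ ∞ g :=
    hX.comp (ContDiff.secant i (by fun_prop) (by fun_prop) (by fun_prop))
  obtain ⟨q, hq, hq1, hq2⟩ := exists_smooth_quotient hg
  refine ⟨fun v => q ((v.1.1, v.2), v.1.2), hq.comp (by fun_prop), fun p s z => ?_, fun p z => ?_⟩
  · have := hq1 (p, z) s
    simp only [g, secant_zero] at this
    simp [this]
  · have h1 := hq2 (p, z)
    have h2 : HasDerivAt (fun s : ℝ => secant i p s z) (coordVec i + z • coordVec i.rev) 0 := by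
      have := ((hasDerivAt_id (0 : ℝ)).smul_const (coordVec i + z • coordVec i.rev)).const_add p
      simpa [secant] using this
    have h3 : HasFDerivAt X (fderiv ℝ X p) (secant i p 0 z) := by
      rw [secant_zero]
      exact (hX.differentiable (by simp) p).hasFDerivAt
    have h4 := h3.comp_hasDerivAt (0 : ℝ) h2
    have := h1.unique h4
    simpa using this

/-- Local structure of the Hugoniot locus: near `p₀` the secants of nonzero jump `s` on which the
Rankine–Hugoniot relation holds are those of slope `s ^ 2 * φ(p, s)`, and `φ` is unchanged when the
two states are exchanged.  The hypotheses say that `∂F/∂w_i` is parallel to `∂X/∂w_i`, and that the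
two eigenvalues at `p₀` are different. -/
theorem exists_hugoniot {X F : Plane → Plane} (hX : ContDiff ℝ ∞ X) (hF : ContDiff ℝ ∞ F)
    {p₀ : Plane} {i : Fin 2}
    (heig : ∀ᶠ p in 𝓝 p₀,
      cross (fderiv ℝ X p (coordVec i)) (fderiv ℝ F p (coordVec i)) = 0)
    (hne : cross (fderiv ℝ X p₀ (coordVec i)) (fderiv ℝ F p₀ (coordVec i.rev)) +
      cross (fderiv ℝ X p₀ (coordVec i.rev)) (fderiv ℝ F p₀ (coordVec i)) ≠ 0) :
    ∃ φ : Plane × ℝ → ℝ, ContDiff ℝ ∞ φ ∧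
      (∀ᶠ v in 𝓝 ((p₀, (0 : ℝ)), (0 : ℝ)), v.1.2 ≠ 0 →
        (rankineHugoniot X F v.1.1 (secant i v.1.1 v.1.2 v.2) = 0 ↔ v.2 = v.1.2 ^ 2 * φ v.1)) ∧
      ∀ᶠ v in 𝓝 (p₀, (0 : ℝ)), φ (secant i v.1 v.2 (v.2 ^ 2 * φ v), -v.2) = φ v := by
  obtain ⟨P, hP, hP1, hP2⟩ := exists_secant_quotient hX i
  obtain ⟨Q, hQ, hQ1, hQ2⟩ := exists_secant_quotient hF i
  let G : (Plane × ℝ) × ℝ → ℝ := fun v => cross (P v) (Q v)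
  have hG : ContDiff ℝ ∞ G := hP.cross hQ
  have hGH : ∀ p s z, rankineHugoniot X F p (secant i p s z) = s ^ 2 * G ((p, s), z) := by
    intro p s z
    rw [rankineHugoniot, hP1, hQ1, cross_smul_smul]
  have hG0 : ∀ᶠ p in 𝓝 p₀, G ((p, 0), 0) = 0 := by
    filter_upwards [heig] with p hp
    simpa [G, hP2, hQ2] using hp
  have hG1 : fderiv ℝ G ((p₀, 0), 0) (0, 1) ≠ 0 := by
    have h1 : HasDerivAt (fun z : ℝ => ((p₀, (0 : ℝ)), z)) ((0 : Plane × ℝ), (1 : ℝ)) 0 :=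
      (hasDerivAt_const (0 : ℝ) _).prodMk (hasDerivAt_id (0 : ℝ))
    have h2 := (hG.differentiable (by simp) ((p₀, 0), 0)).hasFDerivAt.comp_hasDerivAt (0 : ℝ) h1
    have h3 : HasDerivAt (G ∘ fun z : ℝ => ((p₀, (0 : ℝ)), z))
        (cross (fderiv ℝ X p₀ (coordVec i)) (fderiv ℝ F p₀ (coordVec i.rev)) +
          cross (fderiv ℝ X p₀ (coordVec i.rev)) (fderiv ℝ F p₀ (coordVec i))) 0 := by
      have hl : ∀ a b : ℝ, HasDerivAt (fun z : ℝ => a + z * b) b 0 := fun a b => by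
        simpa using ((hasDerivAt_id (0 : ℝ)).mul_const b).const_add a
      have h4 := ((hl (fderiv ℝ X p₀ (coordVec i) 0) (fderiv ℝ X p₀ (coordVec i.rev) 0)).mul
        (hl (fderiv ℝ F p₀ (coordVec i) 1) (fderiv ℝ F p₀ (coordVec i.rev) 1))).sub
        ((hl (fderiv ℝ X p₀ (coordVec i) 1) (fderiv ℝ X p₀ (coordVec i.rev) 1)).mul
        (hl (fderiv ℝ F p₀ (coordVec i) 0) (fderiv ℝ F p₀ (coordVec i.rev) 0)))
      refine (h4.congr_deriv ?_).congr_of_eventuallyEq (Eventually.of_forall fun z => ?_)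
      · simp only [cross]; ring
      · simp [G, cross, hP2, hQ2]
    rw [h2.unique h3]
    exact hne
  obtain ⟨ζ, hζ, hζ0, hζG⟩ := exists_smooth_implicitFunction hG hG0.self_of_nhds hG1
  have hζc : Continuous ζ := hζ.continuous
  have hζz : ∀ᶠ p in 𝓝 p₀, ζ (p, 0) = 0 := by
    have hc : Tendsto (fun p : Plane => ((p, (0 : ℝ)), (0 : ℝ))) (𝓝 p₀) (𝓝 ((p₀, 0), 0)) :=
      Continuous.tendsto (by fun_prop) p₀
    filter_upwards [hc.eventually hζG, hG0] with p h1 h2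
    exact (h1.1 h2).symm
  -- exchanging the two states of a pair on the Hugoniot locus
  let swap : Plane × ℝ → Plane × ℝ := fun v => (secant i v.1 v.2 (ζ v), -v.2)
  have hswap : Continuous swap :=
    (ContDiff.continuous (n := ∞) (ContDiff.secant i (by fun_prop) (by fun_prop) hζ)).prodMk
      (by fun_prop)
  have hswap0 : ∀ p, swap (p, 0) = (p, 0) := fun p => by simp [swap, secant_zero]
  have hswapt : Tendsto swap (𝓝 (p₀, 0)) (𝓝 (p₀, 0)) := by
    simpa [hswap0] using hswap.tendsto (p₀, 0)
  have hζs : ∀ᶠ v in 𝓝 (p₀, (0 : ℝ)), v.2 ≠ 0 → ζ (swap v) = ζ v := by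
    have h1 : Tendsto (fun v => (v, ζ v)) (𝓝 (p₀, (0 : ℝ))) (𝓝 ((p₀, 0), 0)) := by
      simpa [hζ0] using (continuous_id.prodMk hζc).tendsto (p₀, (0 : ℝ))
    have h2 : Tendsto (fun v => (swap v, ζ v)) (𝓝 (p₀, (0 : ℝ))) (𝓝 ((p₀, 0), 0)) := by
      simpa [hζ0, hswap0] using (hswap.prodMk hζc).tendsto (p₀, (0 : ℝ))
    filter_upwards [h1.eventually hζG, h2.eventually hζG] with v hv1 hv2 hv
    have h3 : rankineHugoniot X F v.1 (secant i v.1 v.2 (ζ v)) = 0 := by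
      rw [hGH, hv1.2 rfl, mul_zero]
    rw [rankineHugoniot_symm] at h3
    have h4 := hGH (secant i v.1 v.2 (ζ v)) (-v.2) (ζ v)
    rw [secant_neg_secant, h3] at h4
    have h5 : G (swap v, ζ v) = 0 := by
      rcases mul_eq_zero.1 h4.symm with h | h
      · exact absurd h (by simpa using hv)
      · exact h
    exact (hv2.1 h5).symm
  obtain ⟨α, hα, hα1, -⟩ := exists_smooth_quotient hζ
  have hζα : ∀ᶠ v in 𝓝 (p₀, (0 : ℝ)), ζ v = v.2 * α v := by
    filter_upwards [(continuous_fst.tendsto (p₀, (0 : ℝ))).eventually hζz] with v hv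
    have := hα1 v.1 v.2
    rwa [hv, zero_add, smul_eq_mul] at this
  -- `α` is odd under the exchange, which gives the second order contact
  have hα0 : ∀ᶠ p in 𝓝 p₀, α (p, 0) = 0 := by
    have h1 : ∀ᶠ v in 𝓝 (p₀, (0 : ℝ)), v.2 ≠ 0 → α (swap v) + α v = 0 := by
      filter_upwards [hζα, hswapt.eventually hζα, hζs] with v h1 h2 h3 hv
      have h4 := h3 hv
      rw [h1, h2] at h4
      have h5 : v.2 * (α (swap v) + α v) = 0 := by
        simp only [swap] at h4 ⊢
        linarith
      exact (mul_eq_zero.1 h5).resolve_left hv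
    rw [nhds_prod_eq] at h1
    filter_upwards [h1.curry] with p hp
    have hc : Continuous fun s : ℝ => α (swap (p, s)) + α (p, s) :=
      (hα.continuous.comp (hswap.comp (Continuous.prodMk_right p))).add
        (hα.continuous.comp (Continuous.prodMk_right p))
    have h2 : Tendsto (fun s : ℝ => α (swap (p, s)) + α (p, s)) (𝓝[≠] 0)
        (𝓝 (α (p, 0) + α (p, 0))) := by
      have := hc.tendsto 0
      rw [hswap0] at this
      exact this.mono_left nhdsWithin_le_nhds
    have h3 : Tendsto (fun s : ℝ => α (swap (p, s)) + α (p, s)) (𝓝[≠] 0) (𝓝 0) := by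
      refine tendsto_const_nhds.congr' ?_
      filter_upwards [nhdsWithin_le_nhds hp, self_mem_nhdsWithin] with s hs hs0
      exact (hs hs0).symm
    have := tendsto_nhds_unique h2 h3
    linarith
  obtain ⟨φ, hφ, hφ1, -⟩ := exists_smooth_quotient hα
  have hζφ : ∀ᶠ v in 𝓝 (p₀, (0 : ℝ)), ζ v = v.2 ^ 2 * φ v := by
    filter_upwards [hζα, (continuous_fst.tendsto (p₀, (0 : ℝ))).eventually hα0] with v h1 h2
    have := hφ1 v.1 v.2
    rw [h2, zero_add, smul_eq_mul] at this
    rw [h1]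
    change v.2 * α (v.1, v.2) = _
    rw [this]
    ring
  refine ⟨φ, hφ, ?_, ?_⟩
  · filter_upwards [hζG, (continuous_fst.tendsto ((p₀, (0 : ℝ)), (0 : ℝ))).eventually hζφ]
      with v h1 h2 hv
    rw [hGH, ← h2, ← h1, mul_eq_zero]
    simp [hv]
  · filter_upwards [hζφ, hswapt.eventually hζφ, hζs] with v h1 h2 h3
    rw [← h1]
    change φ (swap v) = φ v
    by_cases hv : v.2 = 0
    · have : v = (v.1, 0) := Prod.ext rfl hv
      rw [this, hswap0]
    · have h4 := h3 hv
      rw [h1, h2] at h4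
      have h5 : (swap v).2 ^ 2 = v.2 ^ 2 := by simp [swap]
      rw [h5] at h4
      exact mul_left_cancel₀ (pow_ne_zero 2 hv) h4

/-! ### Wave curves in Riemann coordinates -/

theorem exists_eq_smul_of_cross_eq_zero {v v' : Plane} (hv : v ≠ 0) (h : cross v v' = 0) :
    ∃ μ : ℝ, v' = μ • v := by
  have h' : v 0 * v' 1 = v 1 * v' 0 := sub_eq_zero.1 h
  by_cases h0 : v 0 = 0
  · have h1 : v 1 ≠ 0 := fun h1 => hv (by ext i; fin_cases i <;> simpa)
    refine ⟨v' 1 / v 1, ?_⟩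
    ext i
    fin_cases i
    · have : v' 0 = 0 := by simpa [h0, h1] using h'.symm
      simp [h0, this]
    · simp [h1]
  · refine ⟨v' 0 / v 0, ?_⟩
    ext i
    fin_cases i
    · simp [h0]
    · simp only [Fin.mk_one, PiLp.smul_apply, smul_eq_mul]
      field_simp
      linarith

theorem cross_smul_self (μ : ℝ) (v : Plane) : cross v (μ • v) = 0 := by
  simp [cross]; ring

theorem secant_apply_self (i : Fin 2) (p : Plane) (s z : ℝ) : secant i p s z i = p i + s := by
  fin_cases i <;> simp [secant]

theorem secant_apply_rev (i : Fin 2) (p : Plane) (s z : ℝ) :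
    secant i p s z i.rev = p i.rev + s * z := by
  fin_cases i <;> simp [secant]

theorem plane_ext (i : Fin 2) {p q : Plane} (h : p i = q i) (h' : p i.rev = q i.rev) : p = q := by
  ext k
  fin_cases i <;> fin_cases k <;> first | exact h | exact h'

/-- The point reached from `p` along a wave of kind `k` and strength `s` of the `i`-th family, in
Riemann coordinates, when the Hugoniot curves are given by the functions `φ i`. -/
noncomputable def wavePoint (φ : Fin 2 → Plane × ℝ → ℝ) (k : WaveKind) (i : Fin 2) (s : ℝ)
    (p : Plane) : Plane :=
  secant i p s (k.star s ^ 2 * φ i (p, s))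

namespace RiemannCoordinates

variable {S : HyperbolicSystem} {ubar : Plane}

theorem contDiffAt_chart (w : RiemannCoordinates S ubar) {u : Plane} (hu : u ∈ w.chart.source) :
    ContDiffAt ℝ ∞ w.chart u :=
  w.smooth_chart.contDiffAt (w.chart.open_source.mem_nhds hu)

theorem contDiffAt_symm (w : RiemannCoordinates S ubar) {p : Plane} (hp : p ∈ w.chart.target) :
    ContDiffAt ℝ ∞ w.chart.symm p :=
  w.smooth_symm.contDiffAt (w.chart.open_target.mem_nhds hp)

theorem fderiv_chart_fderiv_symm (w : RiemannCoordinates S ubar) {p : Plane}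
    (hp : p ∈ w.chart.target) (v : Plane) :
    fderiv ℝ w.chart (w.chart.symm p) (fderiv ℝ w.chart.symm p v) = v := by
  have h1 := ((w.contDiffAt_chart (w.chart.map_target hp)).differentiableAt (by simp)).hasFDerivAt
  have h2 := ((w.contDiffAt_symm hp).differentiableAt (by simp)).hasFDerivAt
  have h3 : HasFDerivAt (w.chart ∘ w.chart.symm) (ContinuousLinearMap.id ℝ Plane) p := by
    refine (hasFDerivAt_id p).congr_of_eventuallyEq ?_
    filter_upwards [w.chart.open_target.mem_nhds hp] with q hq
    exact w.chart.right_inv hq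
  have := (h1.comp p h2).unique h3
  exact congrArg (fun A => A v) this

theorem fderiv_chart_field (w : RiemannCoordinates S ubar) (i : Fin 2) {u : Plane}
    (hu : u ∈ w.chart.source) : fderiv ℝ w.chart u (w.field i u) = coordVec i := by
  have := w.fderiv_chart_fderiv_symm (w.chart.map_source hu) (coordVec i)
  rwa [w.chart.left_inv hu] at this

theorem fderiv_flux_symm (w : RiemannCoordinates S ubar) (i : Fin 2) {p : Plane}
    (hp : p ∈ w.chart.target) :
    fderiv ℝ (S.f ∘ w.chart.symm) p (coordVec i) =
      S.lam i (w.chart.symm p) • fderiv ℝ w.chart.symm p (coordVec i) := by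
  have hu := w.chart.map_target hp
  have hΩ := w.source_subset hu
  have hf : DifferentiableAt ℝ S.f (w.chart.symm p) :=
    (S.smooth_f.contDiffAt (S.isOpen_Ω.mem_nhds hΩ)).differentiableAt (by simp)
  rw [fderiv_comp p hf ((w.contDiffAt_symm hp).differentiableAt (by simp))]
  obtain ⟨a, -, ha⟩ := w.normalized i _ hu
  rw [w.chart.right_inv hp] at ha
  rw [ContinuousLinearMap.comp_apply, ha, map_smul, S.eigen i _ hΩ, smul_comm]

theorem cross_fderiv_symm_ne_zero (w : RiemannCoordinates S ubar) (i : Fin 2) {p : Plane}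
    (hp : p ∈ w.chart.target) :
    cross (fderiv ℝ w.chart.symm p (coordVec i)) (fderiv ℝ w.chart.symm p (coordVec i.rev)) ≠ 0 := by
  intro h
  have hB := w.fderiv_chart_fderiv_symm hp
  have h0 : fderiv ℝ w.chart.symm p (coordVec i) ≠ 0 := fun h0 => by
    have h1 := congrArg (fun q : Plane => q i) (hB (coordVec i))
    simp [h0] at h1
  obtain ⟨μ, hμ⟩ := exists_eq_smul_of_cross_eq_zero h0 h
  have h1 := hB (coordVec i.rev)
  rw [hμ, map_smul, hB] at h1
  have h2 := congrArg (fun q : Plane => q i.rev) h1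
  revert h2
  fin_cases i <;> simp

theorem Rarefaction.chart_eq {w : RiemannCoordinates S ubar} {i : Fin 2} {s : ℝ} {u u' : Plane}
    (h : w.Rarefaction i s u u') : u' ∈ w.chart.source ∧ w.chart u' = secant i (w.chart u) s 0 := by
  obtain ⟨γ, h0, hs, hγ⟩ := h
  refine ⟨hs ▸ (hγ s right_mem_uIcc).1, ?_⟩
  have hd : ∀ t ∈ uIcc 0 s, HasDerivWithinAt (fun t => w.chart (γ t) - t • coordVec i) 0
      (uIcc 0 s) t := by
    intro t ht
    obtain ⟨hm, hd⟩ := hγ t ht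
    have h1 := ((w.contDiffAt_chart hm).differentiableAt (by simp)).hasFDerivAt
    have h2 := h1.comp_hasDerivWithinAt t hd
    rw [w.fderiv_chart_field i hm] at h2
    exact (h2.sub ((hasDerivWithinAt_id t _).smul_const (coordVec i))).congr_deriv (by simp)
  have := (convex_uIcc (0 : ℝ) s).norm_image_sub_le_of_norm_hasDerivWithin_le (C := 0) hd
    (by simp) left_mem_uIcc right_mem_uIcc
  simp only [hs, h0, zero_smul, sub_zero, zero_mul, norm_le_zero_iff, sub_eq_zero] at this
  rw [secant, zero_smul, add_zero, ← this]
  abel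

theorem rarefaction_of_chart_eq (w : RiemannCoordinates S ubar) {i : Fin 2} {s : ℝ} {u u' : Plane}
    (hu : u ∈ w.chart.source) (hu' : u' ∈ w.chart.source)
    (ht : ∀ t ∈ uIcc 0 s, secant i (w.chart u) t 0 ∈ w.chart.target)
    (h : w.chart u' = secant i (w.chart u) s 0) : w.Rarefaction i s u u' := by
  refine ⟨fun t => w.chart.symm (secant i (w.chart u) t 0), ?_, ?_, fun t hts => ?_⟩
  · simp [secant_zero, w.chart.left_inv hu]
  · simp [← h, w.chart.left_inv hu']
  · have hp := ht t hts
    refine ⟨w.chart.map_target hp, ?_⟩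
    have h1 := ((w.contDiffAt_symm hp).differentiableAt (by simp)).hasFDerivAt
    have h2 : HasDerivAt (fun t => secant i (w.chart u) t 0) (coordVec i) t := by
      simpa [secant] using ((hasDerivAt_id t).smul_const (coordVec i)).const_add (w.chart u)
    have h3 := h1.comp_hasDerivAt t h2
    rw [field, w.chart.right_inv hp]
    exact h3.hasDerivWithinAt

theorem Hugoniot.chart_apply {w : RiemannCoordinates S ubar} {i : Fin 2} {s : ℝ} {u u' : Plane}
    (h : w.Hugoniot i s u u') : w.chart u' i = w.chart u i + s := by
  obtain ⟨γ, -, hs, -, -, hγ⟩ := h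
  have := (hγ s right_mem_uIcc).2.1
  rwa [hs] at this

theorem Wave.chart_apply {w : RiemannCoordinates S ubar} {k : WaveKind} {i : Fin 2} {s : ℝ}
    {u u' : Plane} (h : w.Wave k i s u u') : w.chart u' i = w.chart u i + s := by
  have hR : w.Rarefaction i s u u' → w.chart u' i = w.chart u i + s := fun h => by
    rw [h.chart_eq.2, secant_apply_self]
  cases k with
  | lax => exact h.elim (fun h => hR h.2) (fun h => h.2.chart_apply)
  | rar => exact hR h

/-- In Riemann coordinates, the Hugoniot curves are the graphs `w_j = w_j[u] + s ^ 3 * φ(w[u], s)`.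
Only the start of the curve and the jump `s` have to be close to the base point: the curve itself
is then confined to the region where the implicit function theorem describes the locus. -/
theorem exists_hugoniot_iff (w : RiemannCoordinates S ubar) (i : Fin 2) :
    ∃ φ : Plane × ℝ → ℝ, ContDiff ℝ ∞ φ ∧
      (∀ᶠ v in 𝓝 (w.chart ubar, (0 : ℝ)), φ (secant i v.1 v.2 (v.2 ^ 2 * φ v), -v.2) = φ v) ∧
      ∀ᶠ v in 𝓝 (w.chart ubar, (0 : ℝ)), ∀ u ∈ w.chart.source, w.chart u = v.1 → ∀ u',
        w.Hugoniot i v.2 u u' ↔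
          u' ∈ w.chart.source ∧ w.chart u' = secant i v.1 v.2 (v.2 ^ 2 * φ v) := by
  set p₀ := w.chart ubar with hp₀
  have hp₀t : p₀ ∈ w.chart.target := w.chart.map_source w.base_mem
  have hT : ∀ᶠ p in 𝓝 p₀, p ∈ w.chart.target := w.chart.open_target.mem_nhds hp₀t
  obtain ⟨X, hX, hXe⟩ := exists_contDiff_eventuallyEq (g := w.chart.symm) (x₀ := p₀)
    (hT.mono fun p hp => w.contDiffAt_symm hp)
  obtain ⟨F, hF, hFe⟩ := exists_contDiff_eventuallyEq (g := S.f ∘ w.chart.symm) (x₀ := p₀)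
    (hT.mono fun p hp => (S.smooth_f.contDiffAt (S.isOpen_Ω.mem_nhds
      (w.source_subset (w.chart.map_target hp)))).comp p (w.contDiffAt_symm hp))
  have hV : ∀ᶠ p in 𝓝 p₀, fderiv ℝ X p = fderiv ℝ w.chart.symm p ∧
      ∀ i, fderiv ℝ F p (coordVec i) =
        S.lam i (w.chart.symm p) • fderiv ℝ w.chart.symm p (coordVec i) := by
    filter_upwards [hXe.eventually_nhds, hFe.eventually_nhds, hT] with p h1 h2 h3
    have h4 : fderiv ℝ F p = fderiv ℝ (S.f ∘ w.chart.symm) p := EventuallyEq.fderiv_eq h2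
    exact ⟨EventuallyEq.fderiv_eq h1, fun i => by rw [h4, w.fderiv_flux_symm i h3]⟩
  have hlam : S.lam i.rev ubar - S.lam i ubar ≠ 0 := by
    have h := S.strict ubar (w.source_subset w.base_mem)
    fin_cases i
    · exact (sub_pos.2 h).ne'
    · exact (sub_neg.2 h).ne
  obtain ⟨φ, hφ, hφH, hφs⟩ := exists_hugoniot hX hF (p₀ := p₀) (i := i)
    (by
      filter_upwards [hV] with p hp
      rw [hp.2, hp.1, cross_smul_self])
    (by
      obtain ⟨h1, h2⟩ := hV.self_of_nhds
      have h3 : w.chart.symm p₀ = ubar := w.chart.left_inv w.base_mem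
      have h4 := mul_ne_zero hlam (w.cross_fderiv_symm_ne_zero i hp₀t)
      rw [h2, h2, h1, h3]
      convert h4 using 1
      simp only [cross, PiLp.smul_apply, smul_eq_mul]
      ring)
  refine ⟨φ, hφ, hφs, ?_⟩
  -- a box in which the scalar equation for the slope has the unique root `s ^ 2 * φ`
  have hgood : ∀ᶠ p in 𝓝 p₀, p ∈ w.chart.target ∧ X p = w.chart.symm p ∧
      F p = S.f (w.chart.symm p) := hT.and (hXe.and hFe)
  have hsec : Continuous fun v : (Plane × ℝ) × ℝ => secant i v.1.1 v.1.2 v.2 :=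
    ContDiff.continuous (n := ∞) (ContDiff.secant i (by fun_prop) (by fun_prop) (by fun_prop))
  have hsec0 : Tendsto (fun v : (Plane × ℝ) × ℝ => secant i v.1.1 v.1.2 v.2)
      (𝓝 ((p₀, 0), 0)) (𝓝 p₀) := by
    simpa [secant_zero] using hsec.tendsto ((p₀, 0), 0)
  have hfst : Tendsto (fun v : (Plane × ℝ) × ℝ => v.1.1) (𝓝 ((p₀, 0), 0)) (𝓝 p₀) :=
    Continuous.tendsto (by fun_prop) ((p₀, (0 : ℝ)), (0 : ℝ))
  obtain ⟨δ, hδ, hbox⟩ := Metric.eventually_nhds_iff_ball.1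
    (hφH.and ((hsec0.eventually hgood).and (hfst.eventually hgood)))
  have hzc : Continuous fun v : Plane × ℝ => v.2 ^ 2 * φ v := by
    have := hφ.continuous
    fun_prop
  have hzsmall : ∀ᶠ v in 𝓝 (p₀, (0 : ℝ)), |v.2 ^ 2 * φ v| < δ / 2 := by
    have : Tendsto (fun v : Plane × ℝ => |v.2 ^ 2 * φ v|) (𝓝 (p₀, 0)) (𝓝 0) := by
      simpa using hzc.abs.tendsto (p₀, (0 : ℝ))
    exact this.eventually (gt_mem_nhds (by positivity))
  obtain ⟨η, hη, hball⟩ := Metric.eventually_nhds_iff_ball.1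
    (hzsmall.and (Metric.ball_mem_nhds (p₀, (0 : ℝ)) hδ))
  filter_upwards [Metric.ball_mem_nhds (p₀, (0 : ℝ)) hη] with ⟨p, s⟩ hv u hu hup u'
  dsimp only at hup ⊢
  have hpt : ∀ t ∈ uIcc 0 s, |t ^ 2 * φ (p, t)| < δ / 2 ∧ (p, t) ∈ Metric.ball (p₀, (0 : ℝ)) δ := by
    intro t ht
    refine hball (p, t) ?_
    have h1 : |t| ≤ |s| := by
      simpa using abs_sub_left_of_mem_uIcc ht
    rw [Metric.mem_ball, Prod.dist_eq, max_lt_iff, Real.dist_eq, sub_zero] at hv ⊢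
    exact ⟨hv.1, h1.trans_lt hv.2⟩
  have hbox' : ∀ t ∈ uIcc 0 s, ∀ z, |z| < δ →
      ((p, t), z) ∈ Metric.ball ((p₀, (0 : ℝ)), (0 : ℝ)) δ := by
    intro t ht z hz
    rw [Metric.mem_ball, Prod.dist_eq, max_lt_iff, Real.dist_eq, sub_zero]
    exact ⟨(hpt t ht).2, hz⟩
  -- `u` is inside the region where `X` and `F` are the states and the fluxes
  have hXp : X p = u ∧ F p = S.f u := by
    have h := (hbox _ (hbox' s right_mem_uIcc 0 (by simpa using hδ))).2.2
    simp only [← hup, w.chart.left_inv hu] at h ⊢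
    exact h.2
  constructor
  · rintro ⟨γ, h0, hs, hγc, hγd, hγ⟩
    refine ⟨hs ▸ (hγ s right_mem_uIcc).1, ?_⟩
    have hβd : HasDerivWithinAt (fun t => w.chart (γ t)) (coordVec i) (uIcc 0 s) 0 := by
      have hm := (hγ 0 left_mem_uIcc).1
      have h1 := ((w.contDiffAt_chart hm).differentiableAt (by simp)).hasFDerivAt
      have h2 := h1.comp_hasDerivWithinAt 0 hγd
      rwa [← h0, w.fderiv_chart_field i hm] at h2
    have hβc : ContinuousOn (fun t => w.chart (γ t)) (uIcc 0 s) :=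
      w.chart.continuousOn.comp hγc.continuousOn fun t ht => (hγ t ht).1
    let y : ℝ → ℝ := fun t => w.chart (γ t) i.rev - p i.rev
    have hyc : ContinuousOn y (uIcc 0 s) := by
      have := (EuclideanSpace.proj (𝕜 := ℝ) i.rev).continuous.comp_continuousOn hβc
      exact this.sub continuousOn_const
    have hy0 : y 0 = 0 := by simp [y, h0, hup]
    have hyd : HasDerivWithinAt y 0 (uIcc 0 s) 0 := by
      have h1 := (EuclideanSpace.proj (𝕜 := ℝ) i.rev).hasFDerivAt.comp_hasDerivWithinAt 0 hβd
      have h2 := h1.sub_const (p i.rev)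
      refine h2.congr_deriv ?_
      fin_cases i <;> simp
    -- division by zero makes `z 0 = 0`, the limit of the slope
    let z : ℝ → ℝ := fun t => y t / t
    have hzc : ContinuousOn z (uIcc 0 s) := by
      intro t ht
      by_cases ht0 : t = 0
      · subst ht0
        rw [← continuousWithinAt_sdiff_self]
        have := hasDerivWithinAt_iff_tendsto_slope.1 hyd
        have hz0 : z 0 = 0 := by simp [z]
        rw [ContinuousWithinAt, hz0]
        refine this.congr fun t => ?_
        simp [slope, hy0, z, div_eq_inv_mul]
      · exact (hyc t ht).div continuousWithinAt_id ht0
    have hβz : ∀ t ∈ uIcc 0 s, w.chart (γ t) = secant i p t (z t) := by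
      intro t ht
      refine plane_ext i ?_ ?_
      · rw [secant_apply_self, (hγ t ht).2.1, hup]
      · rw [secant_apply_rev]
        by_cases ht0 : t = 0
        · subst ht0
          simp [h0, hup]
        · simp only [z, y]
          field_simp
          ring
    have hroot : ∀ t ∈ uIcc 0 s, |z t| < δ → z t = t ^ 2 * φ (p, t) := by
      intro t ht hz
      by_cases ht0 : t = 0
      · simp [ht0, z]
      · have hb := hbox _ (hbox' t ht _ hz)
        refine (hb.1 ht0).1 ?_
        obtain ⟨hm, -, μ, hμ⟩ := hγ t ht
        have h1 := hb.2.1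
        simp only [← hβz t ht, w.chart.left_inv hm] at h1
        simp only [rankineHugoniot, ← hβz t ht, h1.2.1, h1.2.2, hXp.1, hXp.2, hμ, cross_smul_self]
    -- the slope cannot leave the box, by the intermediate value theorem
    have hzlt : |z s| < δ := by
      by_contra hcon
      have hiv := isPreconnected_uIcc.intermediate_value left_mem_uIcc right_mem_uIcc hzc.abs
      obtain ⟨t, ht, hzt⟩ := hiv (show δ / 2 ∈ Icc |z 0| |z s| from
        ⟨by simp only [z, div_zero, abs_zero]; positivity, by linarith⟩)
      have h1 := hroot t ht (by linarith)
      have h2 := (hpt t ht).1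
      rw [← h1] at h2
      linarith
    rw [← hs, hβz s right_mem_uIcc, hroot s right_mem_uIcc hzlt]
  · rintro ⟨hu', hchart⟩
    let β : ℝ → Plane := fun t => secant i p t (t ^ 2 * φ (p, t))
    have hφp : ContDiff ℝ ∞ fun t => t ^ 2 * φ (p, t) :=
      (contDiff_id.pow 2).mul (hφ.comp (by fun_prop))
    have hβ : ContDiff ℝ ∞ β := ContDiff.secant i (by fun_prop) (by fun_prop) hφp
    have hb : ∀ t ∈ uIcc 0 s, _ := fun t ht =>
      hbox ((p, t), t ^ 2 * φ (p, t)) (hbox' t ht _ ((hpt t ht).1.trans (by linarith)))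
    refine ⟨fun t => w.chart.symm (β t), ?_, ?_, ?_, ?_, ?_⟩
    · simp [β, secant_zero, ← hup, w.chart.left_inv hu]
    · simp [β, ← hchart, w.chart.left_inv hu']
    · exact w.smooth_symm.comp hβ.contDiffOn fun t ht => (hb t ht).2.1.1
    · have hp := (hb 0 left_mem_uIcc).2.1.1
      have h1 := ((w.contDiffAt_symm hp).differentiableAt (by simp)).hasFDerivAt
      have h2 : HasDerivAt β (coordVec i) 0 := by
        have h3 := (hφp.differentiable (by simp) 0).hasDerivAt
        have h4 := (hasDerivAt_id (0 : ℝ)).smul ((h3.smul_const (coordVec i.rev)).const_add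
          (coordVec i))
        simpa [β, secant] using h4.const_add p
      have h3 := h1.comp_hasDerivAt (0 : ℝ) h2
      have h4 : secant i p 0 (0 ^ 2 * φ (p, 0)) = w.chart u := by rw [secant_zero, hup]
      simp only [h4] at h3
      exact h3.hasDerivWithinAt
    · intro t ht
      obtain ⟨h1, ⟨h2, h3, h4⟩, -⟩ := hb t ht
      dsimp only at h1 h2 h3 h4
      refine ⟨w.chart.map_target h2, ?_, ?_⟩
      · rw [w.chart.right_inv h2, secant_apply_self, hup]
      · have hRH : rankineHugoniot X F p (β t) = 0 := by
          by_cases ht0 : t = 0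
          · simp [ht0, β, secant_zero, rankineHugoniot, cross]
          · exact (h1 ht0).2 rfl
        rw [rankineHugoniot, h3, h4, hXp.1, hXp.2] at hRH
        by_cases hne : w.chart.symm (β t) - u = 0
        · refine ⟨0, ?_⟩
          dsimp only
          rw [sub_eq_zero.1 hne]
          simp
        · exact exists_eq_smul_of_cross_eq_zero hne hRH

/-- Near the base point, each wave curve issued from a state is given by `wavePoint`. -/
theorem exists_wave_iff (w : RiemannCoordinates S ubar) :
    ∃ φ : Fin 2 → Plane × ℝ → ℝ, (∀ i, ContDiff ℝ ∞ (φ i)) ∧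
      (∀ i, ∀ᶠ v in 𝓝 (w.chart ubar, (0 : ℝ)),
        φ i (secant i v.1 v.2 (v.2 ^ 2 * φ i v), -v.2) = φ i v) ∧
      ∀ᶠ v in 𝓝 (w.chart ubar, (0 : ℝ)), ∀ (k : WaveKind) (i : Fin 2), ∀ u ∈ w.chart.source,
        w.chart u = v.1 → ∀ u', w.Wave k i v.2 u u' ↔
          u' ∈ w.chart.source ∧ w.chart u' = wavePoint φ k i v.2 v.1 := by
  choose φ hφ hφs hφw using w.exists_hugoniot_iff
  refine ⟨φ, hφ, hφs, ?_⟩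
  have hsec0 : ∀ i, Tendsto (fun v : Plane × ℝ => secant i v.1 v.2 0)
      (𝓝 (w.chart ubar, 0)) (𝓝 (w.chart ubar)) := fun i => by
    have : Continuous fun v : Plane × ℝ => secant i v.1 v.2 0 :=
      ContDiff.continuous (n := ∞) (ContDiff.secant i (by fun_prop) (by fun_prop) (by fun_prop))
    simpa [secant_zero] using this.tendsto (w.chart ubar, 0)
  have hT : ∀ i, ∀ᶠ v in 𝓝 (w.chart ubar, (0 : ℝ)), secant i v.1 v.2 0 ∈ w.chart.target :=
    fun i => (hsec0 i).eventually
      (w.chart.open_target.mem_nhds (w.chart.map_source w.base_mem))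
  obtain ⟨δ, hδ, hball⟩ := Metric.eventually_nhds_iff_ball.1 (eventually_all.2 hT)
  filter_upwards [eventually_all.2 hφw, Metric.ball_mem_nhds (w.chart ubar, (0 : ℝ)) hδ]
    with ⟨p, s⟩ hH hv k i u hu hup u'
  dsimp only at hup ⊢
  have hR : w.Rarefaction i s u u' ↔ u' ∈ w.chart.source ∧ w.chart u' = secant i p s 0 := by
    refine ⟨fun h => hup ▸ h.chart_eq, fun h => w.rarefaction_of_chart_eq hu h.1 (fun t ht => ?_)
      (hup ▸ h.2)⟩
    rw [hup]
    refine hball (p, t) ?_ i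
    have h1 : |t| ≤ |s| := by
      simpa using abs_sub_left_of_mem_uIcc ht
    rw [Metric.mem_ball, Prod.dist_eq, max_lt_iff, Real.dist_eq, sub_zero] at hv ⊢
    exact ⟨hv.1, h1.trans_lt hv.2⟩
  have hS := hH i u hu hup u'
  dsimp only at hS
  cases k with
  | rar => simpa [Wave, wavePoint, WaveKind.star] using hR
  | lax =>
    rw [Wave, hR, hS]
    rcases lt_trichotomy s 0 with h | h | h
    · simp [h.not_ge, h.le, wavePoint, WaveKind.star]
    · subst h
      simp [wavePoint, secant_zero]
    · simp [h.not_ge, h.le, wavePoint, WaveKind.star]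

end RiemannCoordinates

/-! ### The Riemann problem -/

theorem WaveKind.star_sq_le (k : WaveKind) (s : ℝ) : k.star s ^ 2 ≤ s ^ 2 := by
  cases k with
  | lax =>
    rcases le_total s 0 with h | h
    · simp [WaveKind.star, h]
    · simp [WaveKind.star, h]
  | rar => simp [WaveKind.star, sq_nonneg]

/-- Only the square of `σ_*` is of use in `C¹` arguments; the cube carries one more factor `σ`. -/
theorem WaveKind.mul_star_sq (k : WaveKind) (s : ℝ) : s * k.star s ^ 2 = k.star s ^ 3 := by
  cases k with
  | lax =>
    rcases le_total s 0 with h | h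
    · simp [WaveKind.star, h]; ring
    · simp [WaveKind.star, h]
  | rar => simp [WaveKind.star]

theorem WaveKind.star_mul (k : WaveKind) {a : ℝ} (ha : 0 ≤ a) (s : ℝ) :
    k.star (s * a) = k.star s * a := by
  cases k with
  | lax => simp [WaveKind.star, min_mul_of_nonneg _ _ ha]
  | rar => simp [WaveKind.star]

theorem WaveKind.star_zero (k : WaveKind) : k.star 0 = 0 := by
  cases k <;> simp [WaveKind.star]

theorem WaveKind.star_eq_or (k : WaveKind) (s : ℝ) : k.star s = 0 ∨ k.star s = s := by
  cases k with
  | lax => exact (min_choice s 0).symm.imp id id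
  | rar => exact Or.inl rfl

theorem WaveKind.contDiff_star_sq (k : WaveKind) : ContDiff ℝ 1 fun s => k.star s ^ 2 := by
  cases k with
  | rar => simpa [WaveKind.star] using contDiff_const
  | lax =>
    have hd : ∀ s : ℝ, HasDerivAt (fun s : ℝ => min s 0 ^ 2) (2 * min s 0) s := by
      intro s
      rcases lt_trichotomy s 0 with h | h | h
      · rw [min_eq_left h.le]
        have h1 : HasDerivAt (fun s : ℝ => s ^ 2) (2 * s) s := by simpa using hasDerivAt_pow 2 s
        refine h1.congr_of_eventuallyEq ?_
        filter_upwards [gt_mem_nhds h] with t ht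
        rw [min_eq_left ht.le]
      · subst h
        rw [hasDerivAt_iff_isLittleO]
        simp only [min_self, mul_zero, smul_zero, sub_zero, ne_eq, OfNat.ofNat_ne_zero,
          not_false_eq_true, zero_pow]
        refine Asymptotics.IsBigO.trans_isLittleO (g := fun t : ℝ => t ^ 2) ?_ ?_
        · refine Asymptotics.IsBigO.of_bound 1 (Eventually.of_forall fun t => ?_)
          simpa [WaveKind.star] using WaveKind.star_sq_le .lax t
        · simpa using Asymptotics.isLittleO_pow_pow (𝕜 := ℝ) (m := 1) (n := 2) one_lt_two
      · rw [min_eq_right h.le]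
        refine ((hasDerivAt_const s (0 : ℝ)).congr_deriv (by simp)).congr_of_eventuallyEq ?_
        filter_upwards [lt_mem_nhds h] with t ht
        simp [min_eq_right (show (0 : ℝ) ≤ t from le_of_lt ht)]
    rw [contDiff_one_iff_deriv]
    refine ⟨fun s => (hd s).differentiableAt, ?_⟩
    have : deriv (fun s : ℝ => min s 0 ^ 2) = fun s => 2 * min s 0 := funext fun s => (hd s).deriv
    simp only [WaveKind.star, this]
    fun_prop

theorem contDiff_wavePoint {φ : Fin 2 → Plane × ℝ → ℝ} (hφ : ∀ i, ContDiff ℝ ∞ (φ i))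
    {E : Type} [NormedAddCommGroup E] [NormedSpace ℝ E] {g : E → ℝ} {h : E → Plane}
    (k : WaveKind) (i : Fin 2) (hg : ContDiff ℝ 1 g) (hh : ContDiff ℝ 1 h) :
    ContDiff ℝ 1 fun x => wavePoint φ k i (g x) (h x) :=
  ContDiff.secant i hh hg ((k.contDiff_star_sq.comp hg).mul
    (((hφ i).of_le (by exact_mod_cast le_top)).comp (hh.prodMk hg)))

theorem wavePoint_zero (φ : Fin 2 → Plane × ℝ → ℝ) (k : WaveKind) (i : Fin 2) (p : Plane) :
    wavePoint φ k i 0 p = p := secant_zero i p _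

/-- The symmetry of the Hugoniot locus at a point: the curve issued from its end point with the
opposite strength leads back. -/
def IsReversibleAt (φ : Fin 2 → Plane × ℝ → ℝ) (i : Fin 2) (v : Plane × ℝ) : Prop :=
  φ i (secant i v.1 v.2 (v.2 ^ 2 * φ i v), -v.2) = φ i v

/-- A wave can be issued backwards from its right state; on rarefactions the factor `k.star s ^ 2`
vanishes, so the symmetry is needed for shocks only. -/
theorem wavePoint_secant_neg {φ : Fin 2 → Plane × ℝ → ℝ} (k : WaveKind) {i : Fin 2} {p : Plane}
    {s : ℝ} (h : IsReversibleAt φ i (p, -s)) :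
    wavePoint φ k i s (secant i p (-s) (k.star s ^ 2 * φ i (p, -s))) = p := by
  have key : k.star s ^ 2 * φ i (secant i p (-s) (k.star s ^ 2 * φ i (p, -s)), s) =
      k.star s ^ 2 * φ i (p, -s) := by
    rcases k.star_eq_or s with h0 | h0
    · simp [h0]
    · simp only [IsReversibleAt, neg_sq, neg_neg] at h
      rw [h0, h]
  rw [wavePoint, key]
  simpa using secant_neg_secant i p (-s) (k.star s ^ 2 * φ i (p, -s))

theorem eq_secant_neg_wavePoint {φ : Fin 2 → Plane × ℝ → ℝ} (k : WaveKind) {i : Fin 2} {p p' : Plane}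
    {s : ℝ} (h : IsReversibleAt φ i (p, s)) (hp : p' = wavePoint φ k i s p) :
    p = secant i p' (-s) (k.star s ^ 2 * φ i (p', -s)) := by
  have key : k.star s ^ 2 * φ i (p', -s) = k.star s ^ 2 * φ i (p, s) := by
    rcases k.star_eq_or s with h0 | h0
    · simp [h0]
    · simp only [IsReversibleAt] at h
      rw [hp, wavePoint, h0, h]
  rw [key, hp, wavePoint, secant_neg_secant]

/-- The Riemann problem in Riemann coordinates: for states and strengths near the base point, the
strengths are a continuous function of the two states. -/
theorem exists_riemannSolver {φ : Fin 2 → Plane × ℝ → ℝ} (hφ : ∀ i, ContDiff ℝ ∞ (φ i))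
    (p₀ : Plane) (k₁ k₂ : WaveKind) :
    ∃ g : Plane × Plane → ℝ × ℝ, ContinuousAt g (p₀, p₀) ∧ g (p₀, p₀) = 0 ∧
      ∀ᶠ v in 𝓝 ((p₀, p₀), (0 : ℝ × ℝ)),
        v.1.2 = wavePoint φ k₂ 1 v.2.2 (wavePoint φ k₁ 0 v.2.1 v.1.1) ↔ v.2 = g v.1 := by
  let m : (Plane × Plane) × (ℝ × ℝ) → Plane := fun v => wavePoint φ k₁ 0 v.2.1 v.1.1
  have hm : ContDiff ℝ 1 m := contDiff_wavePoint hφ k₁ 0 (by fun_prop) (by fun_prop)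
  let D : (Plane × Plane) × (ℝ × ℝ) → Plane := fun v => wavePoint φ k₂ 1 v.2.2 (m v) - v.1.2
  have hD : ContDiff ℝ 1 D :=
    (contDiff_wavePoint hφ k₂ 1 (by fun_prop) hm).sub (by fun_prop)
  let G : (Plane × Plane) × (ℝ × ℝ) → ℝ × ℝ := fun v => (D v 0, D v 1)
  have hDc := (contDiff_euclidean (n := 1)).1 hD
  have hG : ContDiff ℝ 1 G := (hDc 0).prodMk (hDc 1)
  have hG0 : G ((p₀, p₀), 0) = 0 := by
    simp [G, D, m, wavePoint_zero]
  have hz₁ : ContDiff ℝ 1 fun σ : ℝ × ℝ => k₁.star σ.1 ^ 2 * φ 0 (p₀, σ.1) :=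
    (k₁.contDiff_star_sq.comp contDiff_fst).mul
      (((hφ 0).of_le (by exact_mod_cast le_top)).comp (by fun_prop))
  have hz₂ : ContDiff ℝ 1 fun σ : ℝ × ℝ => k₂.star σ.2 ^ 2 * φ 1 (m ((p₀, p₀), σ), σ.2) :=
    (k₂.contDiff_star_sq.comp contDiff_snd).mul
      (((hφ 1).of_le (by exact_mod_cast le_top)).comp
        ((hm.comp (by fun_prop)).prodMk (by fun_prop)))
  have hmul : ∀ (L : ℝ × ℝ →L[ℝ] ℝ) {z : ℝ × ℝ → ℝ}, ContDiff ℝ 1 z → z 0 = 0 →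
      HasFDerivAt (fun σ => L σ * z σ) (0 : ℝ × ℝ →L[ℝ] ℝ) 0 := by
    intro L z hz h0
    have := L.hasFDerivAt (x := 0).mul (hz.differentiable one_ne_zero 0).hasFDerivAt
    exact this.congr_fderiv (by simp [h0])
  have hG1 : HasFDerivAt (fun σ => G ((p₀, p₀), σ)) (ContinuousLinearMap.id ℝ (ℝ × ℝ)) 0 := by
    have h1 := hmul (.fst ℝ ℝ ℝ) hz₁ (by simp [k₁.star_zero])
    have h2 := hmul (.snd ℝ ℝ ℝ) hz₂ (by simp [k₂.star_zero])
    have h3 := ((ContinuousLinearMap.fst ℝ ℝ ℝ).hasFDerivAt (x := 0)).add h2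
    have h4 := ((ContinuousLinearMap.snd ℝ ℝ ℝ).hasFDerivAt (x := 0)).add h1
    refine ((h3.prodMk h4).congr_fderiv ?_).congr_of_eventuallyEq (Eventually.of_forall fun σ => ?_)
    · ext <;> simp
    · have e0 := secant_apply_self 0 p₀ σ.1 (k₁.star σ.1 ^ 2 * φ 0 (p₀, σ.1))
      have e1 := secant_apply_rev 0 p₀ σ.1 (k₁.star σ.1 ^ 2 * φ 0 (p₀, σ.1))
      have e2 := secant_apply_self 1 (m ((p₀, p₀), σ)) σ.2
        (k₂.star σ.2 ^ 2 * φ 1 (m ((p₀, p₀), σ), σ.2))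
      have e3 := secant_apply_rev 1 (m ((p₀, p₀), σ)) σ.2
        (k₂.star σ.2 ^ 2 * φ 1 (m ((p₀, p₀), σ), σ.2))
      have r0 : Fin.rev (0 : Fin 2) = 1 := rfl
      have r1 : Fin.rev (1 : Fin 2) = 0 := rfl
      rw [r0] at e1
      rw [r1] at e3
      have em : secant 0 p₀ σ.1 (k₁.star σ.1 ^ 2 * φ 0 (p₀, σ.1)) = m ((p₀, p₀), σ) := rfl
      rw [em] at e0 e1
      have eD : D ((p₀, p₀), σ) = secant 1 (m ((p₀, p₀), σ)) σ.2
        (k₂.star σ.2 ^ 2 * φ 1 (m ((p₀, p₀), σ), σ.2)) - p₀ := rfl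
      refine Prod.ext ?_ ?_
      · simp only [G, eD, PiLp.sub_apply, e3, e0, Pi.add_apply, ContinuousLinearMap.coe_fst',
          ContinuousLinearMap.coe_snd']
        ring
      · simp only [G, eD, PiLp.sub_apply, e2, e1, Pi.add_apply, ContinuousLinearMap.coe_fst',
          ContinuousLinearMap.coe_snd']
        ring
  obtain ⟨g, hg, hg0, hgiff⟩ := exists_implicitFunction_of_hasFDerivAt_id hG.contDiffAt hG0 hG1
  refine ⟨g, hg.continuousAt, hg0, ?_⟩
  filter_upwards [hgiff] with v hv
  rw [← hv]
  constructor
  · intro h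
    simp [G, D, m, ← h]
  · intro h
    have h0 : D v 0 = 0 := congrArg Prod.fst h
    have h1 : D v 1 = 0 := congrArg Prod.snd h
    have hDv : D v = 0 := by
      ext j
      fin_cases j
      · exact h0
      · exact h1
    exact (sub_eq_zero.1 hDv).symm

/-! ### The interaction coefficients -/

/-- Shifting the state by `τ • v` and multiplying the strength by `1 + τ β` changes the cubic
deviation of a Hugoniot curve by a smooth multiple of `τ`. -/
theorem exists_dilation_quotient {ψ : Plane × ℝ → ℝ} (hψ : ContDiff ℝ ∞ ψ) :
    ∃ K : (Plane × ℝ × Plane × ℝ) × ℝ → ℝ, ContDiff ℝ ∞ K ∧ ∀ p q v β τ,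
      (1 + τ * β) ^ 3 * ψ (p + τ • v, q * (1 + τ * β)) =
        ψ (p, q) + τ * K ((p, q, v, β), τ) := by
  let E : (Plane × ℝ × Plane × ℝ) × ℝ → ℝ := fun x =>
    (1 + x.2 * x.1.2.2.2) ^ 3 *
      ψ (x.1.1 + x.2 • x.1.2.2.1, x.1.2.1 * (1 + x.2 * x.1.2.2.2))
  have hE : ContDiff ℝ ∞ E := by
    refine ContDiff.mul (by fun_prop) (hψ.comp (by fun_prop))
  obtain ⟨K, hK, hK1, -⟩ := exists_smooth_quotient hE
  refine ⟨K, hK, fun p q v β τ => ?_⟩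
  have := hK1 (p, q, v, β) τ
  simpa [E] using this

/-- The equations that make `σ₁ (1 + σ₂ (σ₂)_*² Γ₁)` and `σ₂ (1 + σ₁ (σ₁)_*² Γ₂)` the strengths of
the outgoing waves when waves of strengths `σ₂` and `σ₁` meet with the middle state `p`. -/
def InteractionEqs (φ : Fin 2 → Plane × ℝ → ℝ) (k₁ k₂ : WaveKind) (p : Plane) (σ₁ σ₂ : ℝ)
    (Γ : ℝ × ℝ) : Prop :=
  (1 + σ₁ * (k₁.star σ₁ ^ 2 * Γ.2)) ^ 3 *
      φ 1 (secant 0 p σ₁ (k₁.star σ₁ ^ 2 * φ 0 (p, σ₁)),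
        -(σ₂ * (1 + σ₁ * (k₁.star σ₁ ^ 2 * Γ.2)))) = φ 1 (p, -σ₂) - σ₁ * Γ.1 ∧
  (1 + σ₂ * (k₂.star σ₂ ^ 2 * Γ.1)) ^ 3 *
      φ 0 (secant 1 p (-σ₂) (k₂.star σ₂ ^ 2 * φ 1 (p, -σ₂)),
        σ₁ * (1 + σ₂ * (k₂.star σ₂ ^ 2 * Γ.1))) = φ 0 (p, σ₁) - σ₂ * Γ.2

/-- The interaction equations are the jump conditions for the outgoing waves: from the left state,
which is given by the incoming 2-wave issued backwards from `p`, they lead to the right state. -/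
theorem InteractionEqs.wavePoint_eq {φ : Fin 2 → Plane × ℝ → ℝ} {k₁ k₂ : WaveKind} {p : Plane}
    {σ₁ σ₂ : ℝ} {Γ : ℝ × ℝ} (h : InteractionEqs φ k₁ k₂ p σ₁ σ₂ Γ)
    (ha : 0 ≤ 1 + σ₂ * (k₂.star σ₂ ^ 2 * Γ.1)) (hb : 0 ≤ 1 + σ₁ * (k₁.star σ₁ ^ 2 * Γ.2))
    (hrev : IsReversibleAt φ 1 (wavePoint φ k₁ 0 σ₁ p,
      -(σ₂ * (1 + σ₁ * (k₁.star σ₁ ^ 2 * Γ.2))))) :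
    wavePoint φ k₂ 1 (σ₂ * (1 + σ₁ * (k₁.star σ₁ ^ 2 * Γ.2)))
      (wavePoint φ k₁ 0 (σ₁ * (1 + σ₂ * (k₂.star σ₂ ^ 2 * Γ.1)))
        (secant 1 p (-σ₂) (k₂.star σ₂ ^ 2 * φ 1 (p, -σ₂)))) = wavePoint φ k₁ 0 σ₁ p := by
  obtain ⟨h1, h2⟩ := h
  -- the new middle state, reached from the left and, backwards, from the right
  have key : wavePoint φ k₁ 0 (σ₁ * (1 + σ₂ * (k₂.star σ₂ ^ 2 * Γ.1)))
        (secant 1 p (-σ₂) (k₂.star σ₂ ^ 2 * φ 1 (p, -σ₂))) =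
      secant 1 (wavePoint φ k₁ 0 σ₁ p) (-(σ₂ * (1 + σ₁ * (k₁.star σ₁ ^ 2 * Γ.2))))
        (k₂.star (σ₂ * (1 + σ₁ * (k₁.star σ₁ ^ 2 * Γ.2))) ^ 2 *
          φ 1 (wavePoint φ k₁ 0 σ₁ p, -(σ₂ * (1 + σ₁ * (k₁.star σ₁ ^ 2 * Γ.2))))) := by
    simp only [wavePoint] at hrev ⊢
    rw [k₁.star_mul ha, k₂.star_mul hb]
    set a := σ₂ * (k₂.star σ₂ ^ 2 * Γ.1) with ha'
    set b := σ₁ * (k₁.star σ₁ ^ 2 * Γ.2) with hb'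
    set x := φ 0 (secant 1 p (-σ₂) (k₂.star σ₂ ^ 2 * φ 1 (p, -σ₂)), σ₁ * (1 + a))
    set y := φ 1 (secant 0 p σ₁ (k₁.star σ₁ ^ 2 * φ 0 (p, σ₁)), -(σ₂ * (1 + b)))
    have e := fun i p s z => secant_apply_self i p s z
    have e0 := fun p s z => secant_apply_rev 0 p s z
    have e1 := fun p s z => secant_apply_rev 1 p s z
    rw [show Fin.rev (0 : Fin 2) = 1 from rfl] at e0
    rw [show Fin.rev (1 : Fin 2) = 0 from rfl] at e1
    refine plane_ext 0 ?_ ?_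
    · rw [e, e1, e1, e]
      linear_combination σ₂ * k₂.star σ₂ ^ 2 * h1 + σ₁ * ha'
    · rw [show Fin.rev (0 : Fin 2) = 1 from rfl, e0, e, e, e0]
      linear_combination σ₁ * k₁.star σ₁ ^ 2 * h2 - σ₂ * hb'
  rw [key]
  exact wavePoint_secant_neg k₂ hrev

/-- A `C¹` function that does not depend on `γ` at `t = 0` depends on it by `O(t)` only. -/
theorem exists_abs_sub_le_of_const {E : Type} [NormedAddCommGroup E] [NormedSpace ℝ E]
    {ψ : E × ℝ × ℝ → ℝ} {x₀ : E} {γ₀ : ℝ} (hψ : ContDiff ℝ 1 ψ)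
    (h0 : ∀ x γ, ψ (x, 0, γ) = ψ (x, 0, 0)) :
    ∃ N : ℝ, 0 ≤ N ∧ ∀ t γ : E → ℝ, Tendsto t (𝓝 x₀) (𝓝 0) → Tendsto γ (𝓝 x₀) (𝓝 γ₀) →
      ∀ᶠ x in 𝓝 x₀, |ψ (x, t x, γ x) - ψ (x, 0, 0)| ≤ N * |t x| := by
  obtain ⟨N, U, hU, hN⟩ := (hψ.contDiffAt (x := (x₀, 0, γ₀))).exists_lipschitzOnWith
  refine ⟨N, N.2, fun t γ ht hγ => ?_⟩
  have h1 : Tendsto (fun x => (x, t x, γ x)) (𝓝 x₀) (𝓝 (x₀, 0, γ₀)) :=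
    tendsto_id.prodMk_nhds (ht.prodMk_nhds hγ)
  have h2 : Tendsto (fun x => (x, (0 : ℝ), γ x)) (𝓝 x₀) (𝓝 (x₀, 0, γ₀)) :=
    tendsto_id.prodMk_nhds (tendsto_const_nhds.prodMk_nhds hγ)
  filter_upwards [h1 hU, h2 hU] with x hx1 hx2
  have := hN.dist_le_mul _ hx1 _ hx2
  rw [h0] at this
  simpa [Prod.dist_eq, Real.dist_eq] using this

/-- The interaction coefficients are `C¹` functions of the middle state and of the incoming
strengths, and the kinds of the curves change each of them by the square of a strength only. -/
theorem exists_interactionCoefficients {φ : Fin 2 → Plane × ℝ → ℝ}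
    (hφ : ∀ i, ContDiff ℝ ∞ (φ i)) (p₀ : Plane) :
    ∃ Γ : WaveKind → WaveKind → Plane × ℝ × ℝ → ℝ × ℝ,
      (∀ k₁ k₂, ContDiffAt ℝ 1 (Γ k₁ k₂) (p₀, 0, 0)) ∧
      (∀ k₁ k₂, ∀ᶠ x in 𝓝 (p₀, (0 : ℝ), (0 : ℝ)),
        InteractionEqs φ k₁ k₂ x.1 x.2.1 x.2.2 (Γ k₁ k₂ x)) ∧
      ∃ M : ℝ, ∀ k₁ k₂ l₁ l₂, ∀ᶠ x in 𝓝 (p₀, (0 : ℝ), (0 : ℝ)),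
        |(Γ k₁ k₂ x).1 - (Γ l₁ l₂ x).1| ≤ M * x.2.1 ^ 2 ∧
        |(Γ k₁ k₂ x).2 - (Γ l₁ l₂ x).2| ≤ M * x.2.2 ^ 2 := by
  choose K hK hKeq using fun i => exists_dilation_quotient (hφ i)
  -- the arguments of the two quotients, with scalar factors in place of the `k.star σ ^ 2`
  let A : (Plane × ℝ × ℝ) × ℝ × ℝ → (Plane × ℝ × Plane × ℝ) × ℝ := fun y =>
    ((y.1.1, -y.1.2.2, coordVec 0 + (y.2.1 * φ 0 (y.1.1, y.1.2.1)) • coordVec 1,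
      y.2.1 * y.2.2), y.1.2.1)
  let B : (Plane × ℝ × ℝ) × ℝ × ℝ → (Plane × ℝ × Plane × ℝ) × ℝ := fun y =>
    ((y.1.1, y.1.2.1, -(coordVec 1 + (y.2.1 * φ 1 (y.1.1, -y.1.2.2)) • coordVec 0),
      y.2.1 * y.2.2), y.1.2.2)
  have hA : ContDiff ℝ ∞ A := by
    have : ContDiff ℝ ∞ fun y : (Plane × ℝ × ℝ) × ℝ × ℝ => φ 0 (y.1.1, y.1.2.1) :=
      (hφ 0).comp (by fun_prop)
    fun_prop
  have hB : ContDiff ℝ ∞ B := by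
    have : ContDiff ℝ ∞ fun y : (Plane × ℝ × ℝ) × ℝ × ℝ => φ 1 (y.1.1, -y.1.2.2) :=
      (hφ 1).comp (by fun_prop)
    fun_prop
  set x₀ : Plane × ℝ × ℝ := (p₀, 0, 0) with hx₀
  let c₀ : ℝ × ℝ := (-K 1 (A (x₀, 0, 0)), -K 0 (B (x₀, 0, 0)))
  have hc : ∀ t : ℝ, A (x₀, 0, t) = A (x₀, 0, 0) ∧ B (x₀, 0, t) = B (x₀, 0, 0) := fun t => by
    simp [A, B]
  have hsolve : ∀ k₁ k₂ : WaveKind, ∃ g : Plane × ℝ × ℝ → ℝ × ℝ, ContDiffAt ℝ 1 g x₀ ∧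
      g x₀ = c₀ ∧ ∀ᶠ x in 𝓝 x₀,
        (g x).1 = -K 1 (A (x, k₁.star x.2.1 ^ 2, (g x).2)) ∧
        (g x).2 = -K 0 (B (x, k₂.star x.2.2 ^ 2, (g x).1)) := by
    intro k₁ k₂
    let G : (Plane × ℝ × ℝ) × ℝ × ℝ → ℝ × ℝ := fun y =>
      (y.2.1 + K 1 (A (y.1, k₁.star y.1.2.1 ^ 2, y.2.2)),
        y.2.2 + K 0 (B (y.1, k₂.star y.1.2.2 ^ 2, y.2.1)))
    have hG : ContDiff ℝ 1 G := by
      have h1 : ContDiff ℝ 1 fun y : (Plane × ℝ × ℝ) × ℝ × ℝ => k₁.star y.1.2.1 ^ 2 :=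
        k₁.contDiff_star_sq.comp (by fun_prop)
      have h2 : ContDiff ℝ 1 fun y : (Plane × ℝ × ℝ) × ℝ × ℝ => k₂.star y.1.2.2 ^ 2 :=
        k₂.contDiff_star_sq.comp (by fun_prop)
      have h3 : ContDiff ℝ 1 (K 1 ∘ A) := ((hK 1).comp hA).of_le (by exact_mod_cast le_top)
      have h4 : ContDiff ℝ 1 (K 0 ∘ B) := ((hK 0).comp hB).of_le (by exact_mod_cast le_top)
      have h5 := h3.comp (contDiff_fst.prodMk (h1.prodMk
        (contDiff_snd.comp (contDiff_snd (𝕜 := ℝ) (E := Plane × ℝ × ℝ) (F := ℝ × ℝ)))))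
      have h6 := h4.comp (contDiff_fst.prodMk (h2.prodMk
        (contDiff_fst.comp (contDiff_snd (𝕜 := ℝ) (E := Plane × ℝ × ℝ) (F := ℝ × ℝ)))))
      exact ((contDiff_fst.comp contDiff_snd).add h5).prodMk
        ((contDiff_snd.comp contDiff_snd).add h6)
    have hGx : ∀ c : ℝ × ℝ, G (x₀, c) = c - c₀ := fun c => by
      have h1 : G (x₀, c) = (c.1 + K 1 (A (x₀, 0, c.2)), c.2 + K 0 (B (x₀, 0, c.1))) := by
        simp [G, hx₀, k₁.star_zero, k₂.star_zero]
      rw [h1, (hc _).1, (hc _).2]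
      simp [c₀, Prod.ext_iff]
    -- at the base point the factors `k.star σ ^ 2` vanish and the system is `c = c₀`
    obtain ⟨g, hg, hg0, hgiff⟩ := exists_implicitFunction_of_hasFDerivAt_id (x₀ := x₀) (y₀ := c₀)
      hG.contDiffAt (by rw [hGx, sub_self]) (by
        simp only [hGx]
        exact (hasFDerivAt_id c₀).sub_const c₀)
    refine ⟨g, hg, hg0, ?_⟩
    have hpair : Tendsto (fun x => (x, g x)) (𝓝 x₀) (𝓝 (x₀, c₀)) := by
      have := (continuousAt_id (x := x₀)).prodMk hg.continuousAt
      simpa [ContinuousAt, hg0] using this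
    filter_upwards [hpair.eventually hgiff] with x hx
    have h1 := hx.2 rfl
    exact ⟨eq_neg_of_add_eq_zero_left (congrArg Prod.fst h1),
      eq_neg_of_add_eq_zero_left (congrArg Prod.snd h1)⟩
  choose Γ hΓ hΓ0 hΓeq using hsolve
  refine ⟨Γ, hΓ, fun k₁ k₂ => ?_, ?_⟩
  · filter_upwards [hΓeq k₁ k₂] with x hx
    obtain ⟨p, σ₁, σ₂⟩ := x
    dsimp only at hx ⊢
    set c := Γ k₁ k₂ (p, σ₁, σ₂)
    constructor
    · have := hKeq 1 p (-σ₂) (coordVec 0 + (k₁.star σ₁ ^ 2 * φ 0 (p, σ₁)) • coordVec 1)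
        (k₁.star σ₁ ^ 2 * c.2) σ₁
      rw [neg_mul] at this
      refine this.trans ?_
      rw [hx.1]
      simp only [A]
      ring
    · have := hKeq 0 p σ₁ (-(coordVec 1 + (k₂.star σ₂ ^ 2 * φ 1 (p, -σ₂)) • coordVec 0))
        (k₂.star σ₂ ^ 2 * c.1) σ₂
      rw [smul_neg, ← neg_smul] at this
      refine this.trans ?_
      rw [hx.2]
      simp only [B]
      ring
  · -- where the factor `k.star σ ^ 2` vanishes, the quotients no longer see the unknown
    have hL := exists_abs_sub_le_of_const (x₀ := x₀) (γ₀ := c₀.2)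
      (((hK 1).comp hA).of_le (by exact_mod_cast le_top)) (fun x γ => by simp [A])
    have hR := exists_abs_sub_le_of_const (x₀ := x₀) (γ₀ := c₀.1)
      (((hK 0).comp hB).of_le (by exact_mod_cast le_top)) (fun x γ => by simp [B])
    obtain ⟨N₁, hN₁, hL⟩ := hL
    obtain ⟨N₂, hN₂, hR⟩ := hR
    have hΓ1 : ∀ k₁ k₂, ∀ᶠ x in 𝓝 x₀,
        |(Γ k₁ k₂ x).1 + K 1 (A (x, 0, 0))| ≤ N₁ * x.2.1 ^ 2 ∧
        |(Γ k₁ k₂ x).2 + K 0 (B (x, 0, 0))| ≤ N₂ * x.2.2 ^ 2 := by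
      intro k₁ k₂
      have ht₁ : Tendsto (fun x : Plane × ℝ × ℝ => k₁.star x.2.1 ^ 2) (𝓝 x₀) (𝓝 0) := by
        have hc : Continuous fun x : Plane × ℝ × ℝ => k₁.star x.2.1 ^ 2 :=
          k₁.contDiff_star_sq.continuous.comp (by fun_prop)
        simpa [hx₀, k₁.star_zero] using hc.tendsto x₀
      have ht₂ : Tendsto (fun x : Plane × ℝ × ℝ => k₂.star x.2.2 ^ 2) (𝓝 x₀) (𝓝 0) := by
        have hc : Continuous fun x : Plane × ℝ × ℝ => k₂.star x.2.2 ^ 2 :=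
          k₂.contDiff_star_sq.continuous.comp (by fun_prop)
        simpa [hx₀, k₂.star_zero] using hc.tendsto x₀
      have hg := (hΓ k₁ k₂).continuousAt.tendsto
      rw [hΓ0] at hg
      filter_upwards [hΓeq k₁ k₂, hL _ _ ht₁ ((continuous_snd.tendsto c₀).comp hg),
        hR _ _ ht₂ ((continuous_fst.tendsto c₀).comp hg)] with x h1 h2 h3
      simp only [Function.comp_apply] at h2 h3
      rw [abs_of_nonneg (sq_nonneg (k₁.star x.2.1))] at h2
      rw [abs_of_nonneg (sq_nonneg (k₂.star x.2.2))] at h3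
      constructor
      · rw [h1.1, neg_add_eq_sub, abs_sub_comm]
        exact h2.trans (mul_le_mul_of_nonneg_left (k₁.star_sq_le _) hN₁)
      · rw [h1.2, neg_add_eq_sub, abs_sub_comm]
        exact h3.trans (mul_le_mul_of_nonneg_left (k₂.star_sq_le _) hN₂)
    refine ⟨2 * (N₁ + N₂), fun k₁ k₂ l₁ l₂ => ?_⟩
    filter_upwards [hΓ1 k₁ k₂, hΓ1 l₁ l₂] with x h1 h2
    have e : ∀ a b c N N' q : ℝ, 0 ≤ N' → 0 ≤ q → |a + c| ≤ N * q → |b + c| ≤ N * q →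
        |a - b| ≤ 2 * (N + N') * q := by
      intro a b c N N' q hN' hq h h'
      have := abs_sub (a + c) (b + c)
      rw [add_sub_add_right_eq_sub] at this
      nlinarith [mul_nonneg hN' hq]
    refine ⟨e _ _ _ _ _ _ hN₂ (sq_nonneg _) h1.1 h2.1, ?_⟩
    rw [add_comm N₁ N₂]
    exact e _ _ _ _ _ _ hN₁ (sq_nonneg _) h1.2 h2.2

/-! ### The interaction estimates -/

theorem WaveKind.eventually_all {α : Type} {l : Filter α} {P : WaveKind → α → Prop}
    (h : ∀ k, ∀ᶠ x in l, P k x) : ∀ᶠ x in l, ∀ k, P k x := by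
  filter_upwards [h .lax, h .rar] with x h1 h2 k
  cases k
  · exact h1
  · exact h2

theorem mul_one_add_mem_Ioo {c σ a : ℝ} (hσ : |σ| < c / 2) (ha : |a| < 1 / 2) :
    σ * (1 + a) ∈ Ioo (-c) c := by
  rw [mem_Ioo, ← abs_lt, abs_mul]
  have h1 : |1 + a| ≤ 3 / 2 := by
    rw [abs_le]
    constructor <;> linarith [abs_lt.1 ha]
  nlinarith [abs_nonneg σ, abs_nonneg (1 + a)]

/-- Replacing a coefficient by one that differs from it by `O(σ²)`. -/
theorem exists_theta {G C M σ τ : ℝ} (h : |G - C| ≤ M * σ ^ 2) (hM : 0 ≤ M) :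
    ∃ θ : ℝ, |θ| ≤ M ∧ σ * (1 + G * τ) = σ * (1 + C * τ + θ * |σ| ^ 2 * τ) := by
  rw [sq_abs]
  by_cases hσ : σ = 0
  · exact ⟨0, by simpa using hM, by simp [hσ]⟩
  · have h2 : 0 < σ ^ 2 := by positivity
    refine ⟨(G - C) / σ ^ 2, ?_, ?_⟩
    · rwa [abs_div, abs_of_pos h2, div_le_iff₀ h2]
    · rw [div_mul_cancel₀ _ h2.ne']
      ring

theorem eventually_abs_interaction_lt {Γ : Plane × ℝ × ℝ → ℝ × ℝ} {p₀ : Plane} (k₁ k₂ : WaveKind)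
    (hΓ : ContinuousAt Γ (p₀, 0, 0)) :
    ∀ᶠ x in 𝓝 (p₀, (0 : ℝ), (0 : ℝ)), |x.2.2 * (k₂.star x.2.2 ^ 2 * (Γ x).1)| < 1 / 2 ∧
      |x.2.1 * (k₁.star x.2.1 ^ 2 * (Γ x).2)| < 1 / 2 := by
  have h1 : ContinuousAt (fun x : Plane × ℝ × ℝ => k₁.star x.2.1 ^ 2) (p₀, 0, 0) :=
    (k₁.contDiff_star_sq.continuous.comp (by fun_prop)).continuousAt
  have h2 : ContinuousAt (fun x : Plane × ℝ × ℝ => k₂.star x.2.2 ^ 2) (p₀, 0, 0) :=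
    (k₂.contDiff_star_sq.continuous.comp (by fun_prop)).continuousAt
  have h3 : ContinuousAt (fun x : Plane × ℝ × ℝ => |x.2.2 * (k₂.star x.2.2 ^ 2 * (Γ x).1)|)
      (p₀, 0, 0) := by fun_prop
  have h4 : ContinuousAt (fun x : Plane × ℝ × ℝ => |x.2.1 * (k₁.star x.2.1 ^ 2 * (Γ x).2)|)
      (p₀, 0, 0) := by fun_prop
  exact (h3.eventually (gt_mem_nhds (by simp))).and (h4.eventually (gt_mem_nhds (by simp)))

theorem proposition2p8 (S : HyperbolicSystem) (hS : S.IsMonotone) (ubar : Plane)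
    (w : RiemannCoordinates S ubar) :
    ∃ (U : Set Plane) (c : ℝ), IsOpen U ∧ ubar ∈ U ∧ U ⊆ w.chart.source ∧ 0 < c ∧
      w.RiemannSolvable U c ∧
      -- waves between states of `U` have their strengths in `(-c, c)`
      (∀ (k : WaveKind) (i : Fin 2) (σ : ℝ), ∀ u ∈ U, ∀ u' ∈ U, w.Wave k i σ u u' →
        σ ∈ Ioo (-c) c) ∧
      ∃ C₁ C₂ : Plane → ℝ → ℝ → ℝ, LipschitzCoefficient C₁ U c ∧ LipschitzCoefficient C₂ U c ∧
        -- classical waves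
        (∀ (σ₁ σ₂ : ℝ) (ul um ur : Plane), w.Incoming U .lax .lax σ₁ σ₂ ul um ur →
          ∃ σ₁' ∈ Ioo (-c) c, ∃ σ₂' ∈ Ioo (-c) c, w.Solves .lax .lax σ₁' σ₂' ul ur ∧
            σ₁' = σ₁ * (1 + C₁ um σ₁ σ₂ * WaveKind.lax.star σ₂ ^ 3) ∧
            σ₂' = σ₂ * (1 + C₂ um σ₁ σ₂ * WaveKind.lax.star σ₁ ^ 3)) ∧
        -- a classical wave and a rarefaction or compression wave; `M` bounds the `O(1)` terms
        (∃ M : ℝ,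
          (∀ (σ₁ σ₂ : ℝ) (ul um ur : Plane), w.Incoming U .rar .lax σ₁ σ₂ ul um ur →
            ∃ σ₁' ∈ Ioo (-c) c, ∃ σ₂' ∈ Ioo (-c) c, w.Solves .rar .lax σ₁' σ₂' ul ur ∧
              (∃ θ : ℝ, |θ| ≤ M ∧
                σ₁' = σ₁ * (1 + C₁ um σ₁ σ₂ * WaveKind.lax.star σ₂ ^ 3
                  + θ * |σ₁| ^ 2 * WaveKind.lax.star σ₂ ^ 3)) ∧
              σ₂' = σ₂) ∧
          (∀ (σ₁ σ₂ : ℝ) (ul um ur : Plane), w.Incoming U .lax .rar σ₁ σ₂ ul um ur →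
            ∃ σ₁' ∈ Ioo (-c) c, ∃ σ₂' ∈ Ioo (-c) c, w.Solves .lax .rar σ₁' σ₂' ul ur ∧
              σ₁' = σ₁ ∧
              (∃ θ : ℝ, |θ| ≤ M ∧
                σ₂' = σ₂ * (1 + C₂ um σ₁ σ₂ * WaveKind.lax.star σ₁ ^ 3
                  + θ * |σ₂| ^ 2 * WaveKind.lax.star σ₁ ^ 3)))) ∧
        -- rarefaction and compression waves
        (∀ (σ₁ σ₂ : ℝ) (ul um ur : Plane), w.Incoming U .rar .rar σ₁ σ₂ ul um ur →
          w.Solves .rar .rar σ₁ σ₂ ul ur) := by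
  obtain ⟨φ, hφ, hrev, hW⟩ := w.exists_wave_iff
  set p₀ := w.chart ubar with hp₀
  have hp₀t : p₀ ∈ w.chart.target := w.chart.map_source w.base_mem
  obtain ⟨Γ, hΓ, hΓeq, M, hM⟩ := exists_interactionCoefficients hφ p₀
  choose g hgc hg0 hg using exists_riemannSolver hφ p₀
  let C : Plane × ℝ × ℝ → ℝ × ℝ := fun y => Γ .lax .lax (w.chart y.1, y.2)
  have hC : ContDiffAt ℝ 1 C (ubar, 0, 0) := by
    refine ContDiffAt.comp (ubar, (0 : ℝ), (0 : ℝ)) (hΓ .lax .lax)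
      (ContDiffAt.prodMk ?_ (by fun_prop))
    exact ContDiffAt.comp (ubar, (0 : ℝ), (0 : ℝ))
      ((w.contDiffAt_chart w.base_mem).of_le (by exact_mod_cast le_top)) contDiffAt_fst
  obtain ⟨L₁, V₁, hV₁, hL₁⟩ := hC.fst.exists_lipschitzOnWith
  obtain ⟨L₂, V₂, hV₂, hL₂⟩ := hC.snd.exists_lipschitzOnWith
  -- a common radius `δ` for the local statements
  obtain ⟨δ₁, hδ₁, hW⟩ := Metric.eventually_nhds_iff_ball.1 (hW.and (eventually_all.2 hrev))
  obtain ⟨δ₂, hδ₂, hg⟩ := Metric.eventually_nhds_iff_ball.1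
    (WaveKind.eventually_all fun k₁ => WaveKind.eventually_all fun k₂ => hg k₁ k₂)
  obtain ⟨δ₃, hδ₃, hV⟩ := Metric.mem_nhds_iff.1 (inter_mem hV₁ hV₂)
  obtain ⟨δ₄, hδ₄, hΓδ⟩ := Metric.eventually_nhds_iff_ball.1
    (WaveKind.eventually_all fun k₁ => WaveKind.eventually_all fun k₂ =>
      (hΓeq k₁ k₂).and ((eventually_abs_interaction_lt k₁ k₂ (hΓ k₁ k₂).continuousAt).and
        (hM k₁ k₂ .lax .lax)))
  have hwp : ∀ k i, ∀ᶠ v in 𝓝 (p₀, (0 : ℝ)),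
      wavePoint φ k i v.2 v.1 ∈ w.chart.target ∩ Metric.ball p₀ δ₁ := fun k i => by
    have hc : Continuous fun v : Plane × ℝ => wavePoint φ k i v.2 v.1 :=
      (contDiff_wavePoint hφ k i contDiff_snd contDiff_fst).continuous
    refine hc.continuousAt.eventually_mem ?_
    rw [wavePoint_zero]
    exact inter_mem (w.chart.open_target.mem_nhds hp₀t) (Metric.ball_mem_nhds _ hδ₁)
  obtain ⟨δ₅, hδ₅, hwp⟩ := Metric.eventually_nhds_iff_ball.1
    (WaveKind.eventually_all fun k => eventually_all.2 (hwp k))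
  obtain ⟨c, hc, hc₁, hc₂, hc₃, hc₄, hc₅⟩ :
      ∃ c : ℝ, 0 < c ∧ c ≤ δ₁ ∧ c ≤ δ₂ ∧ c ≤ δ₃ ∧ c ≤ δ₄ ∧ c ≤ δ₅ :=
    ⟨min δ₁ (min δ₂ (min δ₃ (min δ₄ δ₅))), by positivity, by simp, by simp, by simp, by simp,
      by simp⟩
  have hgball : ∀ k₁ k₂, ∀ᶠ v in 𝓝 (p₀, p₀), g k₁ k₂ v ∈ Metric.ball 0 c := fun k₁ k₂ =>
    (hgc k₁ k₂).eventually_mem (by rw [hg0]; exact Metric.ball_mem_nhds _ hc)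
  obtain ⟨ε', hε', hgε⟩ := Metric.eventually_nhds_iff_ball.1
    (WaveKind.eventually_all fun k₁ => WaveKind.eventually_all fun k₂ => hgball k₁ k₂)
  obtain ⟨ε, hε, hεc, hεε'⟩ : ∃ ε : ℝ, 0 < ε ∧ ε ≤ c / 4 ∧ ε ≤ ε' :=
    ⟨min (c / 4) ε', by positivity, by simp, by simp⟩
  let U : Set Plane := (w.chart.source ∩ w.chart ⁻¹' Metric.ball p₀ ε) ∩ Metric.ball ubar ε
  have hUs : U ⊆ w.chart.source := fun u hu => hu.1.1
  have hUp : ∀ u ∈ U, dist (w.chart u) p₀ < ε := fun u hu => hu.1.2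
  have hU0 : ubar ∈ U := ⟨⟨w.base_mem, by simpa [hp₀] using hε⟩, by simpa using hε⟩
  -- membership in a ball of a product of a space and lines
  have hball : ∀ {p : Plane} {s r : ℝ}, dist p p₀ < r → |s| < r →
      (p, s) ∈ Metric.ball (p₀, (0 : ℝ)) r := fun h1 h2 => by
    simpa [Prod.dist_eq] using ⟨h1, h2⟩
  have hball₂ : ∀ {p q : Plane} {s t r : ℝ}, dist p q < r → |s| < r → |t| < r →
      (p, s, t) ∈ Metric.ball (q, (0 : ℝ), (0 : ℝ)) r := fun h1 h2 h3 => by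
    simpa [Prod.dist_eq] using ⟨h1, h2, h3⟩
  -- strengths of waves between states of `U` stay below `c / 2`, which leaves room for the factors
  -- `1 + a` with `|a| < 1 / 2` of the outgoing strengths
  have hstrength : ∀ (k : WaveKind) (i : Fin 2) (σ : ℝ), ∀ u ∈ U, ∀ u' ∈ U, w.Wave k i σ u u' →
      |σ| < c / 2 := by
    intro k i σ u hu u' hu' h
    have h1 : σ = (w.chart u' - w.chart u) i := by
      rw [PiLp.sub_apply, h.chart_apply]
      ring
    have h2 := PiLp.norm_apply_le (w.chart u' - w.chart u) i
    rw [← h1, Real.norm_eq_abs, ← dist_eq_norm] at h2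
    have h3 := dist_triangle_right (w.chart u') (w.chart u) p₀
    linarith [hUp u hu, hUp u' hu']
  have hsolves : ∀ k₁ k₂ σ₁ σ₂, |σ₁| < c → |σ₂| < c → ∀ ul ∈ U, ∀ ur ∈ w.chart.source,
      (w.Solves k₁ k₂ σ₁ σ₂ ul ur ↔
        w.chart ur = wavePoint φ k₂ 1 σ₂ (wavePoint φ k₁ 0 σ₁ (w.chart ul))) := by
    intro k₁ k₂ σ₁ σ₂ h₁ h₂ ul hul ur hur
    have hl := hUp ul hul
    have hWl := (hW (w.chart ul, σ₁) (hball (by linarith) (by linarith))).1 k₁ 0 ul (hUs hul) rfl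
    obtain ⟨hmt, hmb⟩ := hwp (w.chart ul, σ₁) (hball (by linarith) (by linarith)) k₁ 0
    have hWm := (hW (wavePoint φ k₁ 0 σ₁ (w.chart ul), σ₂) (hball hmb (by linarith))).1 k₂ 1
    constructor
    · rintro ⟨um, h1, h2⟩
      obtain ⟨hm, hme⟩ := (hWl um).1 h1
      exact ((hWm um hm hme ur).1 h2).2
    · intro h
      have hm := w.chart.map_target hmt
      have hme := w.chart.right_inv hmt
      exact ⟨_, (hWl _).2 ⟨hm, hme⟩, (hWm _ hm hme ur).2 ⟨hur, h⟩⟩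
  -- one statement for the four choices of kinds; the coefficient `C` is that of two Lax curves
  have hinter : ∀ k₁ k₂ σ₁ σ₂ ul um ur, w.Incoming U k₁ k₂ σ₁ σ₂ ul um ur →
      ∃ G : ℝ × ℝ, |G.1 - (C (um, σ₁, σ₂)).1| ≤ M * σ₁ ^ 2 ∧
        |G.2 - (C (um, σ₁, σ₂)).2| ≤ M * σ₂ ^ 2 ∧ (k₁ = .lax → k₂ = .lax → G = C (um, σ₁, σ₂)) ∧
        σ₁ * (1 + G.1 * k₂.star σ₂ ^ 3) ∈ Ioo (-c) c ∧
        σ₂ * (1 + G.2 * k₁.star σ₁ ^ 3) ∈ Ioo (-c) c ∧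
        w.Solves k₁ k₂ (σ₁ * (1 + G.1 * k₂.star σ₂ ^ 3)) (σ₂ * (1 + G.2 * k₁.star σ₁ ^ 3))
          ul ur := by
    rintro k₁ k₂ σ₁ σ₂ ul um ur ⟨hul, hum, hur, h₂, h₁⟩
    have hσ₁ := hstrength _ _ _ _ hum _ hur h₁
    have hσ₂ := hstrength _ _ _ _ hul _ hum h₂
    have hl := hUp ul hul
    have hm := hUp um hum
    have hr := hUp ur hur
    obtain ⟨hWl, hrl⟩ := hW (w.chart ul, σ₂) (hball (by linarith) (by linarith))
    obtain ⟨hWm, -⟩ := hW (w.chart um, σ₁) (hball (by linarith) (by linarith))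
    have he₂ := ((hWl k₂ 1 ul (hUs hul) rfl um).1 h₂).2
    have he₁ := ((hWm k₁ 0 um (hUs hum) rfl ur).1 h₁).2
    obtain ⟨heq, ⟨ha, hb⟩, hM₁, hM₂⟩ := hΓδ (w.chart um, σ₁, σ₂)
      (hball₂ (by linarith) (by linarith) (by linarith)) k₁ k₂
    set G := Γ k₁ k₂ (w.chart um, σ₁, σ₂) with hG
    dsimp only at ha hb heq
    have hs₁ := mul_one_add_mem_Ioo hσ₁ ha
    have hs₂ := mul_one_add_mem_Ioo hσ₂ hb
    have hpl := eq_secant_neg_wavePoint k₂ (hrl 1) he₂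
    dsimp only at he₁
    have hrr := (hW (w.chart ur, -(σ₂ * (1 + σ₁ * (k₁.star σ₁ ^ 2 * G.2))))
      (hball (by linarith) (by rw [abs_neg]; exact (abs_lt.2 hs₂).trans_le hc₁))).2 1
    rw [he₁] at hrr
    have hfin := heq.wavePoint_eq (by linarith [(abs_lt.1 ha).1]) (by linarith [(abs_lt.1 hb).1]) hrr
    rw [← hpl, ← he₁] at hfin
    have e₁ : 1 + G.1 * k₂.star σ₂ ^ 3 = 1 + σ₂ * (k₂.star σ₂ ^ 2 * G.1) := by
      rw [← k₂.mul_star_sq]; ring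
    have e₂ : 1 + G.2 * k₁.star σ₁ ^ 3 = 1 + σ₁ * (k₁.star σ₁ ^ 2 * G.2) := by
      rw [← k₁.mul_star_sq]; ring
    refine ⟨G, hM₁, hM₂, ?_, ?_⟩
    · rintro rfl rfl
      rfl
    · rw [e₁, e₂]
      exact ⟨hs₁, hs₂, (hsolves _ _ _ _ (abs_lt.2 hs₁) (abs_lt.2 hs₂) ul hul ur (hUs hur)).2
        hfin.symm⟩
  have hLip : ∀ {y : Plane × ℝ × ℝ}, y ∈ U ×ˢ (Ioo (-c) c ×ˢ Ioo (-c) c) → y ∈ V₁ ∩ V₂ := by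
    rintro ⟨u, s, t⟩ ⟨hu, hs, ht⟩
    exact hV (hball₂ (lt_of_lt_of_le hu.2 (by linarith)) ((abs_lt.2 hs).trans_le hc₃)
      ((abs_lt.2 ht).trans_le hc₃))
  refine ⟨U, c, (w.chart.isOpen_inter_preimage Metric.isOpen_ball).inter Metric.isOpen_ball, hU0,
    hUs, hc, ?_, ?_, fun u s t => (C (u, s, t)).1, fun u s t => (C (u, s, t)).2,
    ⟨L₁, hL₁.mono fun y hy => (hLip hy).1⟩, ⟨L₂, hL₂.mono fun y hy => (hLip hy).2⟩,
    ?_, ⟨|M|, ?_, ?_⟩, ?_⟩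
  · intro k₁ k₂ ul hul ur hur
    have hl := hUp ul hul
    have hr := hUp ur hur
    have hiff : ∀ σ : ℝ × ℝ, |σ.1| < c → |σ.2| < c →
        (w.Solves k₁ k₂ σ.1 σ.2 ul ur ↔ σ = g k₁ k₂ (w.chart ul, w.chart ur)) := by
      intro σ h₁ h₂
      rw [hsolves k₁ k₂ σ.1 σ.2 h₁ h₂ ul hul ur (hUs hur)]
      refine hg ((w.chart ul, w.chart ur), σ) ?_ k₁ k₂
      simp only [Metric.mem_ball, Prod.dist_eq, max_lt_iff, Prod.fst_zero, Prod.snd_zero,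
        Real.dist_eq, sub_zero]
      refine ⟨⟨?_, ?_⟩, ?_, ?_⟩ <;> linarith
    have hgc' := hgε (w.chart ul, w.chart ur)
      (by simpa [Prod.dist_eq] using ⟨hl.trans_le hεε', hr.trans_le hεε'⟩) k₁ k₂
    simp only [Metric.mem_ball, Prod.dist_eq, max_lt_iff, Prod.fst_zero, Prod.snd_zero,
      Real.dist_eq, sub_zero] at hgc'
    refine ⟨g k₁ k₂ (w.chart ul, w.chart ur), ⟨⟨abs_lt.1 hgc'.1, abs_lt.1 hgc'.2⟩,
      (hiff _ hgc'.1 hgc'.2).2 rfl⟩, ?_⟩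
    rintro σ ⟨⟨h₁, h₂⟩, h⟩
    exact (hiff σ (abs_lt.2 h₁) (abs_lt.2 h₂)).1 h
  · intro k i σ u hu u' hu' h
    exact abs_lt.1 ((hstrength k i σ u hu u' hu' h).trans (by linarith))
  · intro σ₁ σ₂ ul um ur h
    obtain ⟨G, -, -, hG, hs₁, hs₂, hsol⟩ := hinter _ _ _ _ _ _ _ h
    rw [hG rfl rfl] at hs₁ hs₂ hsol
    exact ⟨_, hs₁, _, hs₂, hsol, rfl, rfl⟩
  · intro σ₁ σ₂ ul um ur h
    obtain ⟨G, hM₁, -, -, hs₁, hs₂, hsol⟩ := hinter _ _ _ _ _ _ _ h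
    have hθ := exists_theta (τ := WaveKind.lax.star σ₂ ^ 3)
      (hM₁.trans (mul_le_mul_of_nonneg_right (le_abs_self M) (sq_nonneg σ₁))) (abs_nonneg M)
    exact ⟨_, hs₁, _, hs₂, hsol, hθ, by simp [WaveKind.star]⟩
  · intro σ₁ σ₂ ul um ur h
    obtain ⟨G, -, hM₂, -, hs₁, hs₂, hsol⟩ := hinter _ _ _ _ _ _ _ h
    have hθ := exists_theta (τ := WaveKind.lax.star σ₁ ^ 3)
      (hM₂.trans (mul_le_mul_of_nonneg_right (le_abs_self M) (sq_nonneg σ₂))) (abs_nonneg M)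
    exact ⟨_, hs₁, _, hs₂, hsol, by simp [WaveKind.star], hθ⟩
  · intro σ₁ σ₂ ul um ur h
    obtain ⟨G, -, -, -, -, -, hsol⟩ := hinter _ _ _ _ _ _ _ h
    simpa [WaveKind.star] using hsol
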